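/- Let $A$ be a commutative ring with unit and let $\mathbb{W}(A)$ be its ring of big Witt vectors: the set of vectors $(a_n)_{n\geq 1}$ with the natural ring structure for which all ghost maps $w_n(a)=\sum_{d\mid n}d\,a_d^{n/d}$ are ring homomorphisms. Let $F_n\colon\mathbb{W}(A)\to\mathbb{W}(A)$ ($n\geq 1$) be the $n$th Frobenius, the natural ring homomorphism with $w_m(F_n(a))=w_{mn}(a)$, and let $\Delta\colon\mathbb{W}(A)\to\mathbb{W}(\mathbb{W}(A))$ be the natural ring homomorphism with $w_n(\Delta(a))=F_n(a)$; write $\Delta_e(a)$ for the $e$th Witt component of $\Delta(a)$. Let $\Omega^1_{\mathbb{W}(A)}$ be the $\mathbb{W}(A)$-module of absolute Kähler differentials, let $d\colon\mathbb{W}(A)\to\Omega^1_{\mathbb{W}(A)}$ be the universal derivation, and let $F_n\colon\Omega^1_{\mathbb{W}(A)}\to\Omega^1_{\mathbb{W}(A)}$ be the unique $F_n$-linear map with $$F_n(da)=\sum_{e\mid n}\Delta_e(a)^{(n/e)-1}\,d\Delta_e(a).$$ Let $d\log[-1]=[-1]^{-1}d[-1]=[-1]d[-1]$, where $[-1]$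 is the Teichmüller representative of $-1$. Define the graded $\mathbb{W}(A)$-algebra $$\hat{\Omega}^{\cdot}_{\mathbb{W}(A)}=T^{\cdot}_{\mathbb{W}(A)}\Omega^1_{\mathbb{W}(A)}/J^{\cdot},$$ where $T^{\cdot}$ is the tensor algebra and $J^{\cdot}$ is the graded (two-sided) ideal generated by all elements $da\otimes da-d\log[-1]\otimes F_2(da)$ with $a\in\mathbb{W}(A)$. Then: 1. $\hat{\Omega}^{\cdot}_{\mathbb{W}(A)}$ is anti-symmetric: $x\cdot y=(-1)^{pq}\,y\cdot x$ for $x$ of degree $p$ and $y$ of degree $q$. 2. There is a unique graded derivation $d\colon\hat{\Omega}^{\cdot}_{\mathbb{W}(A)}\to\hat{\Omega}^{\cdot}_{\mathbb{W}(A)}$ (additive, of degree $1$, with $d(xy)=dx\cdot y+(-1)^{p}x\cdot dy$ for $x$ of degree $p$) that extends $d\colon\mathbb{W}(A)\to\Omega^1_{\mathbb{W}(A)}$ and satisfies $dd\omega=d\log[-1]\cdot d\omega$ for all $\omega$. Moreover, $d(d\log[-1])=0$. 3. For every integer $n\geq 1$ there is a unique homomorphism of graded rings $F_n\colon\hat{\Omega}^{\cdot}_{\mathbb{W}(A)}\to\hat{\Omega}^{\cdot}_{\mathbb{W}(A)}$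 that is given by $F_n\colon\mathbb{W}(A)\to\mathbb{W}(A)$ in degree $0$ and by $F_n\colon\Omega^1_{\mathbb{W}(A)}\to\Omega^1_{\mathbb{W}(A)}$ in degree $1$. In addition, $dF_n=nF_nd$ with $d$ the derivation of part 2. -/

import Mathlib

open scoped KaehlerDifferential

universe u v

noncomputable section

/-- The set `A^ℕ` of big Witt vectors; the index set consists of the positive integers. -/
@[ext]
structure BigWitt (A : Type u) where
  /-- The Witt components. -/
  coeff : ℕ+ → A

namespace BigWitt

section Dwork

/-- The `n`-th ghost polynomial `∑_{d ∣ n} d * a_d ^ (n / d)` of a sequence, for `n ≥ 1`. -/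
def gh {A : Type u} [CommRing A] (a : ℕ → A) (n : ℕ) : A :=
  ∑ d ∈ n.divisors, (d : A) * a d ^ (n / d)

theorem gh_eq {A : Type u} [CommRing A] (a : ℕ → A) {n : ℕ} (hn : n ≠ 0) :
    gh a n = ∑ d ∈ n.properDivisors, (d : A) * a d ^ (n / d) + n * a n := by
  rw [gh, ← Nat.cons_self_properDivisors hn, Finset.sum_cons, Nat.div_self (Nat.pos_of_ne_zero hn),
    pow_one, add_comm]

/-- No positive integer is a zero divisor. -/
def TorsionFree (A : Type u) [CommRing A] : Prop :=
  ∀ n : ℕ, n ≠ 0 → ∀ a : A, (n : A) * a = 0 → a = 0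

theorem gh_inj {A : Type u} [CommRing A] (hA : TorsionFree A) {a b : ℕ → A}
    (h : ∀ n, n ≠ 0 → gh a n = gh b n) : ∀ n, n ≠ 0 → a n = b n := by
  intro n
  induction n using Nat.strong_induction_on with
  | _ n ih =>
    intro hn
    have h1 := h n hn
    rw [gh_eq _ hn, gh_eq _ hn] at h1
    have h2 : ∑ d ∈ n.properDivisors, (d : A) * a d ^ (n / d)
        = ∑ d ∈ n.properDivisors, (d : A) * b d ^ (n / d) := by
      refine Finset.sum_congr rfl fun d hd => ?_
      rw [Nat.mem_properDivisors] at hd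
      rw [ih d hd.2 (fun h0 => hn (by simpa [h0] using hd.1))]
    rw [h2] at h1
    have h3 := add_left_cancel h1
    exact sub_eq_zero.1 (hA n hn _ (by rw [mul_sub, h3, sub_self]))

/-- The congruences `x_{pm} ≡ φ_p (x_m)` modulo the powers of `p` dividing `pm`. -/
def Cong {A : Type u} [CommRing A] (φ : ℕ → A →+* A) (x : ℕ → A) : Prop :=
  ∀ p : ℕ, p.Prime → ∀ m, m ≠ 0 → ∀ j, p ^ j ∣ p * m → (p : A) ^ j ∣ x (p * m) - φ p (x m)

/-- Each `φ_p` lifts the `p`-th power map modulo `p`. -/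
def FrobLift {A : Type u} [CommRing A] (φ : ℕ → A →+* A) : Prop :=
  ∀ p : ℕ, p.Prime → ∀ a, (p : A) ∣ φ p a - a ^ p

theorem pow_aux {A : Type u} [CommRing A] {p : ℕ} {x y : A}
    (h : (p : A) ∣ x - y) {k : ℕ} (i : ℕ) (hk : p ^ i ∣ k) :
    (p : A) ^ (i + 1) ∣ x ^ k - y ^ k := by
  obtain ⟨c, rfl⟩ := hk
  rw [pow_mul, pow_mul]
  exact (dvd_sub_pow_of_dvd_sub h i).trans (sub_dvd_pow_sub_pow _ _ _)

theorem term_dvd {A : Type u} [CommRing A] {φ : ℕ → A →+* A} (hφ : FrobLift φ) (a : ℕ → A)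
    {p : ℕ} (hp : p.Prime) {d k j : ℕ} (hd : d ≠ 0) (hk : k ≠ 0) (hj : p ^ j ∣ p * (d * k)) :
    (p : A) ^ j ∣ (d : A) * a d ^ (p * k) - φ p ((d : A) * a d ^ k) := by
  obtain ⟨i, hi, hdi⟩ : ∃ i l, p ^ i ∣ d ∧ p ^ l ∣ k ∧ j ≤ i + (l + 1) := by
    refine ⟨d.factorization p, k.factorization p, Nat.ordProj_dvd d p, Nat.ordProj_dvd k p, ?_⟩
    have h1 := (hp.pow_dvd_iff_le_factorization
      (mul_ne_zero hp.ne_zero (mul_ne_zero hd hk))).1 hj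
    rw [Nat.factorization_mul hp.ne_zero (mul_ne_zero hd hk), Nat.factorization_mul hd hk] at h1
    simp only [Finsupp.add_apply, hp.factorization_self] at h1
    omega
  obtain ⟨h1, h2, h3⟩ := hdi
  have h4 : (p : A) ∣ a d ^ p - φ p (a d) := by
    rw [← neg_sub]; exact (dvd_neg).2 (hφ p hp (a d))
  have h5 := pow_aux h4 hi h2
  rw [← pow_mul] at h5
  rw [map_mul, map_natCast, map_pow, ← mul_sub]
  refine (pow_dvd_pow _ h3).trans ?_
  rw [pow_add]
  refine mul_dvd_mul ?_ h5
  rw [← Nat.cast_pow]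
  exact Nat.cast_dvd_cast h1

theorem cong_aux {A : Type u} [CommRing A] {φ : ℕ → A →+* A} (hφ : FrobLift φ) (a : ℕ → A)
    {p : ℕ} (hp : p.Prime) {m : ℕ} (hm : m ≠ 0) {j : ℕ} (hj : p ^ j ∣ p * m)
    (s : Finset ℕ) (hs : ∀ d ∈ s, d ∣ p * m) (hs' : m.divisors ⊆ s) :
    (p : A) ^ j ∣ ∑ d ∈ s, (d : A) * a d ^ (p * m / d) - φ p (gh a m) := by
  rw [← Finset.sum_sdiff hs', gh, map_sum, add_sub_assoc, ← Finset.sum_sub_distrib]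
  refine dvd_add (Finset.dvd_sum fun d hd => ?_) (Finset.dvd_sum fun d hd => ?_)
  · rw [Finset.mem_sdiff, Nat.mem_divisors] at hd
    have h1 := hs d hd.1
    have h2 : ¬ d ∣ m := fun h => hd.2 ⟨h, hm⟩
    refine Dvd.dvd.mul_right ?_ _
    rw [← Nat.cast_pow]
    refine Nat.cast_dvd_cast ?_
    obtain ⟨e, he⟩ := h1
    have h3 : ¬ p ∣ e := by
      rintro ⟨f, rfl⟩
      refine h2 ⟨f, Nat.eq_of_mul_eq_mul_left hp.pos ?_⟩
      rw [he]; ring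
    rw [he] at hj
    exact (((Nat.Prime.coprime_iff_not_dvd hp).2 h3).pow_left j).dvd_of_dvd_mul_right hj
  · rw [Nat.mem_divisors] at hd
    obtain ⟨k, rfl⟩ := hd.1
    have hd0 : d ≠ 0 := fun h => hm (by simp [h])
    have hk0 : k ≠ 0 := fun h => hm (by simp [h])
    have e1 : p * (d * k) / d = p * k := by
      rw [show p * (d * k) = d * (p * k) by ring, Nat.mul_div_cancel_left _ (Nat.pos_of_ne_zero hd0)]
    have e2 : d * k / d = k := Nat.mul_div_cancel_left _ (Nat.pos_of_ne_zero hd0)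
    rw [e1, e2]
    exact term_dvd hφ a hp hd0 hk0 hj


theorem Cong.of_gh {A : Type u} [CommRing A] {φ : ℕ → A →+* A} (hφ : FrobLift φ) (a : ℕ → A) :
    Cong φ (gh a) := fun _ hp _ hm _ hj =>
  cong_aux hφ a hp hm hj _ (fun _ hd => (Nat.mem_divisors.1 hd).1)
    (Nat.divisors_subset_of_dvd (mul_ne_zero hp.ne_zero hm) (dvd_mul_left _ _))

theorem cast_dvd_of_prime_pow {A : Type u} [CommRing A] (y : A) (n : ℕ) (hn : n ≠ 0)
    (h : ∀ p : ℕ, p.Prime → ∀ j, p ^ j ∣ n → (p : A) ^ j ∣ y) : (n : A) ∣ y := by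
  induction n using Nat.recOnPosPrimePosCoprime with
  | prime_pow p k hp _ => simpa using h p hp k dvd_rfl
  | zero => exact absurd rfl hn
  | one => simp
  | coprime a b ha hb hab iha ihb =>
    rw [Nat.cast_mul]
    exact (Nat.Coprime.cast hab).mul_dvd
      (iha (by omega) fun p hp j hj => h p hp j (hj.mul_right _))
      (ihb (by omega) fun p hp j hj => h p hp j (hj.mul_left _))

open Classical in
/-- The recursive solution of the equations `gh a n = x n`. -/
def dworkSol {A : Type u} [CommRing A] (x : ℕ → A) (n : ℕ) : A :=
  if h : ∃ y : A, ∑ d ∈ n.properDivisors.attach, (d.1 : A) * dworkSol x d.1 ^ (n / d.1) + n * y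
    = x n then h.choose else 0
termination_by n
decreasing_by exact (Nat.mem_properDivisors.1 d.2).2

/-- Dwork's lemma: a sequence satisfying the congruences lies in the image of the ghost map. -/
theorem gh_dworkSol {A : Type u} [CommRing A] {φ : ℕ → A →+* A} (hφ : FrobLift φ) {x : ℕ → A}
    (hx : Cong φ x) : ∀ n, n ≠ 0 → gh (dworkSol x) n = x n := by
  intro n
  induction n using Nat.strong_induction_on with
  | _ n ih =>
    intro hn
    have key : (n : A) ∣ x n - ∑ d ∈ n.properDivisors, (d : A) * dworkSol x d ^ (n / d) := by
      refine cast_dvd_of_prime_pow _ n hn fun p hp j hj => ?_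
      by_cases hpn : p ∣ n
      · obtain ⟨m, rfl⟩ := hpn
        have hm : m ≠ 0 := fun h => hn (by simp [h])
        have hlt : m < p * m := by
          have := hp.two_le
          nlinarith [Nat.pos_of_ne_zero hm]
        have h1 := hx p hp m hm j hj
        have h2 := cong_aux hφ (dworkSol x) hp hm hj (p * m).properDivisors
          (fun d hd => (Nat.mem_properDivisors.1 hd).1) (fun d hd => by
            rw [Nat.mem_divisors] at hd
            exact Nat.mem_properDivisors.2 ⟨hd.1.mul_left _,
              (Nat.le_of_dvd (Nat.pos_of_ne_zero hm) hd.1).trans_lt hlt⟩)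
        rw [ih m hlt hm] at h2
        have h3 := dvd_sub h1 h2
        rwa [sub_sub_sub_cancel_right] at h3
      · rcases Nat.eq_zero_or_pos j with rfl | hj0
        · simp
        · exact absurd ((dvd_pow_self p hj0.ne').trans hj) hpn
    have hex : ∃ y : A, ∑ d ∈ n.properDivisors.attach,
        (d.1 : A) * dworkSol x d.1 ^ (n / d.1) + n * y = x n := by
      obtain ⟨y, hy⟩ := key
      refine ⟨y, ?_⟩
      rw [Finset.sum_attach n.properDivisors fun d => (d : A) * dworkSol x d ^ (n / d), ← hy]
      ring
    have hval : dworkSol x n = hex.choose := by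
      rw [dworkSol, dif_pos hex]
    rw [gh_eq _ hn, hval, ← Finset.sum_attach]
    exact hex.choose_spec

theorem frobLift_expand (σ : Type u) :
    FrobLift fun p => (MvPolynomial.expand p : MvPolynomial σ ℤ →ₐ[ℤ] _).toRingHom := by
  intro p hp a
  have : Fact p.Prime := ⟨hp⟩
  have : (p : MvPolynomial σ ℤ) = MvPolynomial.C (p : ℤ) := by simp
  rw [this, MvPolynomial.C_dvd_iff_zmod]
  simp only [AlgHom.toRingHom_eq_coe, RingHom.coe_coe, map_sub, map_pow]
  rw [MvPolynomial.map_expand, MvPolynomial.expand_zmod, sub_self]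

theorem torsionFree_mvPolynomial (σ : Type u) : TorsionFree (MvPolynomial σ ℤ) := by
  intro n hn a h
  exact (mul_eq_zero.1 h).resolve_left (Nat.cast_ne_zero.2 hn)

theorem gh_map {A : Type u} {B : Type v} [CommRing A] [CommRing B] (f : A →+* B) (a : ℕ → A)
    (n : ℕ) : gh (fun d => f (a d)) n = f (gh a n) := by
  simp [gh, map_sum]

namespace Cong

variable {A : Type u} [CommRing A] {φ : ℕ → A →+* A} {x y : ℕ → A}

theorem add (hx : Cong φ x) (hy : Cong φ y) : Cong φ fun n => x n + y n := by
  intro p hp m hm j hj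
  rw [map_add, add_sub_add_comm]
  exact dvd_add (hx p hp m hm j hj) (hy p hp m hm j hj)

theorem mul (hx : Cong φ x) (hy : Cong φ y) : Cong φ fun n => x n * y n := by
  intro p hp m hm j hj
  have h : x (p * m) * y (p * m) - φ p (x m) * φ p (y m)
      = (x (p * m) - φ p (x m)) * y (p * m) + φ p (x m) * (y (p * m) - φ p (y m)) := by ring
  rw [map_mul, h]
  exact dvd_add ((hx p hp m hm j hj).mul_right _) ((hy p hp m hm j hj).mul_left _)

theorem neg (hx : Cong φ x) : Cong φ fun n => - x n := by
  intro p hp m hm j hj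
  rw [map_neg, ← neg_sub', dvd_neg]
  exact hx p hp m hm j hj

theorem frob (hx : Cong φ x) (n : ℕ) (hn : n ≠ 0) : Cong φ fun m => x (n * m) := by
  intro p hp m hm j hj
  have := hx p hp (n * m) (mul_ne_zero hn hm) j (by
    rw [mul_left_comm]; exact hj.mul_left _)
  rwa [mul_left_comm] at this

end Cong

end Dwork

section Basic

variable {A : Type u} {B : Type v} [CommRing A] [CommRing B]

/-- The components of a Witt vector, indexed by natural numbers. -/
def seq (x : BigWitt A) (d : ℕ) : A := x.coeff d.toPNat'

/-- The ghost component `w_n(x) = ∑_{d ∣ n} d * x_d ^ (n / d)`. -/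
def ghost (n : ℕ+) (x : BigWitt A) : A :=
  ∑ d ∈ (n : ℕ).divisors, (d : A) * x.coeff d.toPNat' ^ ((n : ℕ) / d)

theorem ghost_eq_gh (n : ℕ+) (x : BigWitt A) : ghost n x = gh x.seq n := rfl

/-- Functoriality: apply a ring homomorphism to all the components. -/
def map (f : A →+* B) (x : BigWitt A) : BigWitt B := ⟨fun n => f (x.coeff n)⟩

theorem map_seq (f : A →+* B) (x : BigWitt A) (n : ℕ) : (map f x).seq n = f (x.seq n) := rfl

theorem ghost_map (f : A →+* B) (n : ℕ+) (x : BigWitt A) : ghost n (map f x) = f (ghost n x) :=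
  gh_map f x.seq n

theorem map_map {C : Type*} [CommRing C] (f : A →+* B) (g : B →+* C) (x : BigWitt A) :
    map g (map f x) = map (g.comp f) x := rfl

theorem ext_ghost (hA : TorsionFree A) {x y : BigWitt A} (h : ∀ n, ghost n x = ghost n y) :
    x = y := by
  ext n
  have := gh_inj hA (a := x.seq) (b := y.seq)
    (fun n hn => h ⟨n, Nat.pos_of_ne_zero hn⟩) n n.ne_zero
  simpa [seq] using this

/-- A Witt vector with the given sequence of ghost components, when there is one by Dwork's
lemma. -/
def solve (x : ℕ → A) : BigWitt A := ⟨fun n => dworkSol x n⟩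

theorem ghost_solve {φ : ℕ → A →+* A} (hφ : FrobLift φ) {x : ℕ → A} (hx : Cong φ x) (n : ℕ+) :
    ghost n (solve x) = x n := by
  rw [← gh_dworkSol hφ hx n n.ne_zero, ghost_eq_gh]
  refine Finset.sum_congr rfl fun d hd => ?_
  have : 0 < d := Nat.pos_of_mem_divisors hd
  simp [seq, solve, PNat.toPNat'_coe this]

/-- The vector of the first variables in `ℤ[a_n, b_n]`. -/
def genL : BigWitt (MvPolynomial (ℕ+ ⊕ ℕ+) ℤ) := ⟨fun n => MvPolynomial.X (Sum.inl n)⟩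

/-- The vector of the second variables in `ℤ[a_n, b_n]`. -/
def genR : BigWitt (MvPolynomial (ℕ+ ⊕ ℕ+) ℤ) := ⟨fun n => MvPolynomial.X (Sum.inr n)⟩

/-- The ring homomorphism `ℤ[a_n, b_n] → A` that maps `a` to `x` and `b` to `y`. -/
def eval₂ (x y : BigWitt A) : MvPolynomial (ℕ+ ⊕ ℕ+) ℤ →+* A :=
  MvPolynomial.eval₂Hom (Int.castRingHom A) (Sum.elim x.coeff y.coeff)

theorem map_genL (x y : BigWitt A) : map (eval₂ x y) genL = x := by
  ext n; simp [map, genL, eval₂]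

theorem map_genR (x y : BigWitt A) : map (eval₂ x y) genR = y := by
  ext n; simp [map, genR, eval₂]

theorem comp_eval₂ (f : A →+* B) (x y : BigWitt A) :
    f.comp (eval₂ x y) = eval₂ (map f x) (map f y) := by
  refine MvPolynomial.ringHom_ext (fun r => by simp [eval₂]) fun i => ?_
  cases i <;> simp [eval₂, map]

/-- The vector of the variables in `ℤ[a_n]`. -/
def gen : BigWitt (MvPolynomial ℕ+ ℤ) := ⟨fun n => MvPolynomial.X n⟩

/-- The ring homomorphism `ℤ[a_n] → A` that maps `a` to `x`. -/
def eval₁ (x : BigWitt A) : MvPolynomial ℕ+ ℤ →+* A :=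
  MvPolynomial.eval₂Hom (Int.castRingHom A) x.coeff

theorem map_gen (x : BigWitt A) : map (eval₁ x) gen = x := by
  ext n; simp [map, gen, eval₁]

theorem comp_eval₁ (f : A →+* B) (x : BigWitt A) : f.comp (eval₁ x) = eval₁ (map f x) := by
  refine MvPolynomial.ringHom_ext (fun r => by simp [eval₁]) fun i => ?_
  simp [eval₁, map]

theorem cong_gh {σ : Type u} (x : BigWitt (MvPolynomial σ ℤ)) :
    Cong (fun p => (MvPolynomial.expand p : MvPolynomial σ ℤ →ₐ[ℤ] _).toRingHom) (gh x.seq) :=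
  Cong.of_gh (frobLift_expand σ) _

/-- The Teichmüller representative. -/
def teichmuller (a : A) : BigWitt A := ⟨fun n => if n = 1 then a else 0⟩

/-- The universal polynomials for the sum. -/
def addPoly : BigWitt (MvPolynomial (ℕ+ ⊕ ℕ+) ℤ) := solve fun n => gh genL.seq n + gh genR.seq n

/-- The universal polynomials for the product. -/
def mulPoly : BigWitt (MvPolynomial (ℕ+ ⊕ ℕ+) ℤ) := solve fun n => gh genL.seq n * gh genR.seq n

/-- The universal polynomials for the opposite. -/
def negPoly : BigWitt (MvPolynomial ℕ+ ℤ) := solve fun n => - gh gen.seq n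

/-- The universal polynomials for the `m`-th Frobenius. -/
def frobPoly (m : ℕ+) : BigWitt (MvPolynomial ℕ+ ℤ) := solve fun n => gh gen.seq (m * n)

instance : Zero (BigWitt A) := ⟨⟨fun _ => 0⟩⟩
instance : One (BigWitt A) := ⟨teichmuller 1⟩
instance : Add (BigWitt A) := ⟨fun x y => map (eval₂ x y) addPoly⟩
instance : Mul (BigWitt A) := ⟨fun x y => map (eval₂ x y) mulPoly⟩
instance : Neg (BigWitt A) := ⟨fun x => map (eval₁ x) negPoly⟩

/-- The underlying map of the `m`-th Frobenius. -/
def frobFun (m : ℕ+) (x : BigWitt A) : BigWitt A := map (eval₁ x) (frobPoly m)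

theorem ghost_zero (n : ℕ+) : ghost n (0 : BigWitt A) = 0 := by
  refine Finset.sum_eq_zero fun d hd => ?_
  change (d : A) * 0 ^ ((n : ℕ) / d) = 0
  have : (n : ℕ) / d ≠ 0 := (Nat.div_pos (Nat.divisor_le hd) (Nat.pos_of_mem_divisors hd)).ne'
  rw [zero_pow this, mul_zero]

theorem ghost_teichmuller (n : ℕ+) (a : A) : ghost n (teichmuller a) = a ^ (n : ℕ) := by
  rw [ghost, Finset.sum_eq_single 1]
  · simp [teichmuller, show Nat.toPNat' 1 = 1 from rfl]
  · intro d hd hd1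
    have h0 : 0 < d := Nat.pos_of_mem_divisors hd
    have h1 : d.toPNat' ≠ 1 := fun h => hd1 (by
      rw [← PNat.toPNat'_coe h0, h]; rfl)
    have h2 : (n : ℕ) / d ≠ 0 := (Nat.div_pos (Nat.divisor_le hd) h0).ne'
    simp [teichmuller, h1, h2]
  · simp

theorem ghost_one (n : ℕ+) : ghost n (1 : BigWitt A) = 1 := by
  rw [show (1 : BigWitt A) = teichmuller 1 from rfl, ghost_teichmuller, one_pow]

theorem ghost_add (n : ℕ+) (x y : BigWitt A) : ghost n (x + y) = ghost n x + ghost n y := by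
  rw [show x + y = map (eval₂ x y) addPoly from rfl, ghost_map, addPoly,
    ghost_solve (frobLift_expand _) ((cong_gh genL).add (cong_gh genR)), map_add, ← ghost_eq_gh,
    ← ghost_eq_gh, ← ghost_map, ← ghost_map, map_genL, map_genR]

theorem ghost_mul (n : ℕ+) (x y : BigWitt A) : ghost n (x * y) = ghost n x * ghost n y := by
  rw [show x * y = map (eval₂ x y) mulPoly from rfl, ghost_map, mulPoly,
    ghost_solve (frobLift_expand _) ((cong_gh genL).mul (cong_gh genR)), map_mul, ← ghost_eq_gh,
    ← ghost_eq_gh, ← ghost_map, ← ghost_map, map_genL, map_genR]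

theorem ghost_neg (n : ℕ+) (x : BigWitt A) : ghost n (-x) = - ghost n x := by
  rw [show -x = map (eval₁ x) negPoly from rfl, ghost_map, negPoly,
    ghost_solve (frobLift_expand _) (cong_gh gen).neg, map_neg, ← ghost_eq_gh,
    ← ghost_map, map_gen]

theorem ghost_frobFun (m n : ℕ+) (x : BigWitt A) : ghost n (frobFun m x) = ghost (m * n) x := by
  rw [frobFun, ghost_map, frobPoly,
    ghost_solve (frobLift_expand _) ((cong_gh gen).frob m m.ne_zero)]
  rw [show gh gen.seq (m * n : ℕ) = ghost (m * n) gen from rfl, ← ghost_map, map_gen]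

theorem map_zero' (f : A →+* B) : map f 0 = 0 := by
  ext n; exact map_zero f

theorem map_teichmuller (f : A →+* B) (a : A) : map f (teichmuller a) = teichmuller (f a) := by
  ext n; simp only [map, teichmuller]; split_ifs <;> simp

theorem map_one' (f : A →+* B) : map f 1 = 1 :=
  (map_teichmuller f 1).trans (by rw [_root_.map_one]; rfl)

theorem map_add' (f : A →+* B) (x y : BigWitt A) : map f (x + y) = map f x + map f y := by
  change map f (map (eval₂ x y) addPoly) = map (eval₂ (map f x) (map f y)) addPoly
  rw [map_map, comp_eval₂]

theorem map_mul' (f : A →+* B) (x y : BigWitt A) : map f (x * y) = map f x * map f y := by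
  change map f (map (eval₂ x y) mulPoly) = map (eval₂ (map f x) (map f y)) mulPoly
  rw [map_map, comp_eval₂]

theorem map_neg' (f : A →+* B) (x : BigWitt A) : map f (-x) = - map f x := by
  change map f (map (eval₁ x) negPoly) = map (eval₁ (map f x)) negPoly
  rw [map_map, comp_eval₁]

theorem map_frobFun (f : A →+* B) (m : ℕ+) (x : BigWitt A) :
    map f (frobFun m x) = frobFun m (map f x) := by
  rw [frobFun, frobFun, map_map, comp_eval₁]

/-- Every Witt vector is the image of one over a torsion free ring. -/
def cover (A : Type u) [CommRing A] : MvPolynomial A ℤ →+* A :=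
  MvPolynomial.eval₂Hom (Int.castRingHom A) id

/-- A lift of a Witt vector to the torsion free ring `ℤ[A]`. -/
def lift (x : BigWitt A) : BigWitt (MvPolynomial A ℤ) := ⟨fun n => MvPolynomial.X (x.coeff n)⟩

theorem map_lift (x : BigWitt A) : map (cover A) (lift x) = x := by
  ext n; simp [map, lift, cover]

theorem ext_ghost_mv {σ : Type u} {x y : BigWitt (MvPolynomial σ ℤ)}
    (h : ∀ n, ghost n x = ghost n y) : x = y := ext_ghost (torsionFree_mvPolynomial σ) h

/-- The ring of big Witt vectors: the ring operations are the natural ones for which the ghost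
components are ring homomorphisms. -/
instance : CommRing (BigWitt A) where
  add_assoc x y z := by
    rw [← map_lift x, ← map_lift y, ← map_lift z]
    simp only [← map_add']
    exact congrArg _ (ext_ghost_mv fun n => by simp only [ghost_add]; ring)
  zero_add x := by
    rw [← map_lift x, ← map_zero' (cover A)]
    simp only [← map_add']
    exact congrArg _ (ext_ghost_mv fun n => by simp only [ghost_add, ghost_zero]; ring)
  add_zero x := by
    rw [← map_lift x, ← map_zero' (cover A)]
    simp only [← map_add']
    exact congrArg _ (ext_ghost_mv fun n => by simp only [ghost_add, ghost_zero]; ring)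
  add_comm x y := by
    rw [← map_lift x, ← map_lift y]
    simp only [← map_add']
    exact congrArg _ (ext_ghost_mv fun n => by simp only [ghost_add]; ring)
  neg_add_cancel x := by
    rw [← map_lift x, ← map_zero' (cover A)]
    simp only [← map_add', ← map_neg']
    exact congrArg _ (ext_ghost_mv fun n => by
      simp only [ghost_add, ghost_neg, ghost_zero]; ring)
  mul_assoc x y z := by
    rw [← map_lift x, ← map_lift y, ← map_lift z]
    simp only [← map_mul']
    exact congrArg _ (ext_ghost_mv fun n => by simp only [ghost_mul]; ring)
  one_mul x := by
    rw [← map_lift x, ← map_one' (cover A)]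
    simp only [← map_mul']
    exact congrArg _ (ext_ghost_mv fun n => by simp only [ghost_mul, ghost_one]; ring)
  mul_one x := by
    rw [← map_lift x, ← map_one' (cover A)]
    simp only [← map_mul']
    exact congrArg _ (ext_ghost_mv fun n => by simp only [ghost_mul, ghost_one]; ring)
  mul_comm x y := by
    rw [← map_lift x, ← map_lift y]
    simp only [← map_mul']
    exact congrArg _ (ext_ghost_mv fun n => by simp only [ghost_mul]; ring)
  left_distrib x y z := by
    rw [← map_lift x, ← map_lift y, ← map_lift z]
    simp only [← map_mul', ← map_add']
    exact congrArg _ (ext_ghost_mv fun n => by simp only [ghost_mul, ghost_add]; ring)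
  right_distrib x y z := by
    rw [← map_lift x, ← map_lift y, ← map_lift z]
    simp only [← map_mul', ← map_add']
    exact congrArg _ (ext_ghost_mv fun n => by simp only [ghost_mul, ghost_add]; ring)
  zero_mul x := by
    rw [← map_lift x, ← map_zero' (cover A)]
    simp only [← map_mul']
    exact congrArg _ (ext_ghost_mv fun n => by simp only [ghost_mul, ghost_zero]; ring)
  mul_zero x := by
    rw [← map_lift x, ← map_zero' (cover A)]
    simp only [← map_mul']
    exact congrArg _ (ext_ghost_mv fun n => by simp only [ghost_mul, ghost_zero]; ring)
  nsmul := nsmulRec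
  zsmul := zsmulRec

/-- The ghost components as ring homomorphisms. -/
def ghostHom (n : ℕ+) : BigWitt A →+* A where
  toFun := ghost n
  map_zero' := ghost_zero n
  map_one' := ghost_one n
  map_add' := ghost_add n
  map_mul' := ghost_mul n

/-- `map f` as a ring homomorphism. -/
def mapHom (f : A →+* B) : BigWitt A →+* BigWitt B where
  toFun := map f
  map_zero' := map_zero' f
  map_one' := map_one' f
  map_add' := map_add' f
  map_mul' := map_mul' f

/-- The `m`-th Frobenius `F_m : W(A) → W(A)`, the natural ring homomorphism with
`w_n (F_m x) = w_{mn} x`. -/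
def frobenius (m : ℕ+) : BigWitt A →+* BigWitt A where
  toFun := frobFun m
  map_zero' := by
    rw [← map_zero' (cover A), ← map_frobFun]
    exact congrArg _ (ext_ghost_mv fun n => by simp only [ghost_frobFun, ghost_zero])
  map_one' := by
    rw [← map_one' (cover A), ← map_frobFun]
    exact congrArg _ (ext_ghost_mv fun n => by simp only [ghost_frobFun, ghost_one])
  map_add' x y := by
    rw [← map_lift x, ← map_lift y]
    simp only [← map_add', ← map_frobFun]
    exact congrArg _ (ext_ghost_mv fun n => by simp only [ghost_frobFun, ghost_add])
  map_mul' x y := by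
    rw [← map_lift x, ← map_lift y]
    simp only [← map_mul', ← map_frobFun]
    exact congrArg _ (ext_ghost_mv fun n => by simp only [ghost_frobFun, ghost_mul])

theorem ghost_frobenius (m n : ℕ+) (x : BigWitt A) :
    ghost n (frobenius m x) = ghost (m * n) x := ghost_frobFun m n x

theorem map_frobenius (f : A →+* B) (m : ℕ+) (x : BigWitt A) :
    map f (frobenius m x) = frobenius m (map f x) := map_frobFun f m x

end Basic

section Delta

variable {A : Type u} {B : Type v} [CommRing A] [CommRing B]

theorem torsionFree (hA : TorsionFree A) : TorsionFree (BigWitt A) := by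
  intro n hn x h
  refine ext_ghost hA fun m => ?_
  rw [ghost_zero]
  refine hA n hn _ ?_
  have := congrArg (ghostHom m) h
  rwa [map_mul, map_natCast, map_zero] at this

theorem frobLift_aux (hA : TorsionFree A) {φ : ℕ → A →+* A} (hφ : FrobLift φ) (p : ℕ+)
    (hp : (p : ℕ).Prime) (x : BigWitt A) : (p : BigWitt A) ∣ frobenius p x - x ^ (p : ℕ) := by
  have hc := Cong.of_gh hφ x.seq
  have hp0 : (p : ℕ) ≠ 0 := hp.ne_zero
  have hex : ∀ n : ℕ, ∃ y : A, n ≠ 0 → (p : A) * y = gh x.seq (p * n) - gh x.seq n ^ (p : ℕ) := by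
    intro n
    by_cases hn : n = 0
    · exact ⟨0, fun h => absurd hn h⟩
    have h1 := hc p hp n hn 1 (by simp)
    rw [pow_one] at h1
    have h2 := dvd_add h1 (hφ p hp (gh x.seq n))
    rw [sub_add_sub_cancel] at h2
    obtain ⟨y, hy⟩ := h2
    exact ⟨y, fun _ => hy.symm⟩
  choose y hy using hex
  have hcy : Cong φ y := by
    intro q hq m hm j hj
    have hqm : q * m ≠ 0 := mul_ne_zero hq.ne_zero hm
    have e : (p : A) * (y (q * m) - φ q (y m))
        = (gh x.seq (q * (p * m)) - φ q (gh x.seq (p * m)))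
          - (gh x.seq (q * m) ^ (p : ℕ) - φ q (gh x.seq m) ^ (p : ℕ)) := by
      have h3 := congrArg (φ q) (hy m hm)
      rw [map_mul, map_natCast, map_sub, map_pow] at h3
      rw [mul_sub, hy _ hqm, h3, mul_left_comm (p : ℕ) q m]
      ring
    have hpm : (p : ℕ) * m ≠ 0 := mul_ne_zero hp0 hm
    by_cases hqp : q = p
    · subst hqp
      rcases Nat.eq_zero_or_pos j with rfl | hj0
      · simp
      have d1 := hc p hp (p * m) hpm (j + 1) (by rw [pow_succ']; exact mul_dvd_mul_left _ hj)
      have d2 : (p : A) ^ (j + 1) ∣ gh x.seq (p * m) ^ (p : ℕ) - φ p (gh x.seq m) ^ (p : ℕ) := by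
        have h4 := hc p hp m hm j hj
        rw [← geom_sum₂_mul, pow_succ']
        exact mul_dvd_mul (dvd_geom_sum₂_self ((dvd_pow_self _ hj0.ne').trans h4)) h4
      obtain ⟨z, hz⟩ := dvd_sub d1 d2
      rw [← e, pow_succ', mul_assoc] at hz
      refine ⟨z, sub_eq_zero.1 (hA p hp0 _ ?_)⟩
      rw [mul_sub, hz, sub_self]
    · have d1 := hc q hq (p * m) hpm j (by rw [mul_left_comm]; exact hj.mul_left _)
      have d2 := (hc q hq m hm j hj).trans (sub_dvd_pow_sub_pow _ _ (p : ℕ))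
      have d3 := dvd_sub d1 d2
      rw [← e] at d3
      have hco : IsCoprime ((q : A) ^ j) (p : A) := by
        have := (Nat.Coprime.cast (R := A) ((Nat.coprime_primes hq hp).2 hqp))
        exact this.pow_left
      exact hco.dvd_of_dvd_mul_left d3
  refine ⟨solve y, ext_ghost hA fun n => ?_⟩
  change ghostHom n _ = ghostHom n _
  rw [map_mul, map_natCast, map_sub, map_pow]
  change ghost n (frobenius p x) - ghost n x ^ (p : ℕ) = (p : A) * ghost n (solve y)
  rw [ghost_solve hφ hcy, hy n n.ne_zero, ghost_frobenius]
  rfl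

theorem frobenius_frobenius (m n : ℕ+) (x : BigWitt A) :
    frobenius m (frobenius n x) = frobenius (m * n) x := by
  rw [← map_lift x]
  simp only [← map_frobenius]
  exact congrArg _ (ext_ghost_mv fun k => by simp only [ghost_frobenius]; congr 1; ring)

theorem frobLift_frobenius (σ : Type u) :
    FrobLift fun p => (frobenius p.toPNat' :
      BigWitt (MvPolynomial σ ℤ) →+* BigWitt (MvPolynomial σ ℤ)) := by
  intro p hp x
  have h := frobLift_aux (torsionFree_mvPolynomial σ) (frobLift_expand σ) p.toPNat'
    (by rwa [PNat.toPNat'_coe hp.pos]) x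
  rwa [PNat.toPNat'_coe hp.pos] at h

theorem cong_frobenius (x : BigWitt A) :
    Cong (fun p => frobenius p.toPNat') fun n => frobenius n.toPNat' x := by
  intro p hp m hm j _
  have : (p * m).toPNat' = p.toPNat' * m.toPNat' := by
    apply PNat.eq
    rw [PNat.mul_coe, PNat.toPNat'_coe hp.pos, PNat.toPNat'_coe (Nat.pos_of_ne_zero hm),
      PNat.toPNat'_coe (Nat.mul_pos hp.pos (Nat.pos_of_ne_zero hm))]
  simp only [frobenius_frobenius, this, sub_self, dvd_zero]

/-- The underlying map of `Δ`. -/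
def deltaFun (x : BigWitt A) : BigWitt (BigWitt A) :=
  map (mapHom (eval₁ x)) (solve fun n => frobenius n.toPNat' gen)

theorem ghost_deltaFun (n : ℕ+) (x : BigWitt A) : ghost n (deltaFun x) = frobenius n x := by
  rw [deltaFun, ghost_map, ghost_solve (frobLift_frobenius _) (cong_frobenius gen),
    PNat.coe_toPNat']
  change map (eval₁ x) _ = _
  rw [map_frobenius, map_gen]

theorem map_deltaFun (f : A →+* B) (x : BigWitt A) :
    map (mapHom f) (deltaFun x) = deltaFun (map f x) := by
  rw [deltaFun, deltaFun, map_map, ← comp_eval₁]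
  rfl

theorem ext_ghost_mv₂ {σ : Type u} {x y : BigWitt (BigWitt (MvPolynomial σ ℤ))}
    (h : ∀ n, ghost n x = ghost n y) : x = y :=
  ext_ghost (torsionFree (torsionFree_mvPolynomial σ)) h

/-- The natural ring homomorphism `Δ : W(A) → W(W(A))` with `w_n (Δ x) = F_n x`. -/
def delta : BigWitt A →+* BigWitt (BigWitt A) where
  toFun := deltaFun
  map_zero' := by
    rw [← map_zero' (cover A), ← map_deltaFun, ← map_zero' (mapHom (cover A))]
    exact congrArg _ (ext_ghost_mv₂ fun n => by simp only [ghost_deltaFun, ghost_zero, map_zero])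
  map_one' := by
    rw [← map_one' (cover A), ← map_deltaFun, ← map_one' (mapHom (cover A))]
    exact congrArg _ (ext_ghost_mv₂ fun n => by simp only [ghost_deltaFun, ghost_one, map_one])
  map_add' x y := by
    rw [← map_lift x, ← map_lift y]
    simp only [← map_add', ← map_deltaFun]
    exact congrArg _ (ext_ghost_mv₂ fun n => by simp only [ghost_deltaFun, ghost_add, map_add])
  map_mul' x y := by
    rw [← map_lift x, ← map_lift y]
    simp only [← map_mul', ← map_deltaFun]
    exact congrArg _ (ext_ghost_mv₂ fun n => by simp only [ghost_deltaFun, ghost_mul, map_mul])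

theorem ghost_delta (n : ℕ+) (x : BigWitt A) : ghost n (delta x) = frobenius n x :=
  ghost_deltaFun n x

end Delta

section Differentials

variable {R : Type u} {S : Type v} [CommRing R] [CommRing S]

/-- The sum `∑_{e ∣ n} x_e ^ (n / e - 1) d(x_e)`, which is the differential of the `n`-th ghost
component of `x` divided by `n`. -/
def dghost (n : ℕ+) (x : BigWitt R) : Ω[R⁄ℤ] :=
  ∑ e ∈ (n : ℕ).divisors,
    x.coeff e.toPNat' ^ ((n : ℕ) / e - 1) • KaehlerDifferential.D ℤ R (x.coeff e.toPNat')

theorem smul_dghost (n : ℕ+) (x : BigWitt R) :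
    ((n : ℕ) : R) • dghost n x = KaehlerDifferential.D ℤ R (ghost n x) := by
  rw [dghost, ghost, map_sum, Finset.smul_sum]
  refine Finset.sum_congr rfl fun e he => ?_
  obtain ⟨k, hk⟩ := (Nat.mem_divisors.1 he).1
  have he0 : 0 < e := Nat.pos_of_mem_divisors he
  rw [hk, Nat.mul_div_cancel_left _ he0, Derivation.leibniz, Derivation.leibniz_pow,
    Derivation.map_natCast, smul_zero, add_zero, Nat.cast_mul]
  rw [← Nat.cast_smul_eq_nsmul R]
  simp only [smul_smul, mul_assoc]

/-- The map on differentials induced by a ring homomorphism. -/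
def mapΩ (f : R →+* S) : Ω[R⁄ℤ] →+ Ω[S⁄ℤ] :=
  letI := f.toAlgebra
  (KaehlerDifferential.map ℤ ℤ R S).toAddMonoidHom

theorem mapΩ_D (f : R →+* S) (a : R) :
    mapΩ f (KaehlerDifferential.D ℤ R a) = KaehlerDifferential.D ℤ S (f a) :=
  let _ := f.toAlgebra
  KaehlerDifferential.map_D ℤ ℤ R S a

theorem mapΩ_smul (f : R →+* S) (a : R) (w : Ω[R⁄ℤ]) : mapΩ f (a • w) = f a • mapΩ f w := by
  let _ := f.toAlgebra
  change KaehlerDifferential.map ℤ ℤ R S (a • w) = _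
  rw [map_smul]
  exact algebra_compatible_smul S a _

theorem dghost_map (f : R →+* S) (n : ℕ+) (x : BigWitt R) :
    dghost n (map f x) = mapΩ f (dghost n x) := by
  simp only [dghost, map_sum, mapΩ_smul, mapΩ_D, map_pow]
  rfl

theorem smul_cancel {σ : Type u} [i : Algebra ℤ (MvPolynomial σ ℤ)] (n : ℕ+)
    {v w : Ω[MvPolynomial σ ℤ⁄ℤ]}
    (h : ((n : ℕ) : MvPolynomial σ ℤ) • v = ((n : ℕ) : MvPolynomial σ ℤ) • w) : v = w := by
  obtain rfl : i = AddMonoidAlgebra.algebra := Subsingleton.elim _ _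
  let b := KaehlerDifferential.mvPolynomialBasis ℤ σ
  refine b.repr.injective (Finsupp.ext fun i => ?_)
  have := congrArg (fun z => b.repr z i) h
  simpa [n.ne_zero] using this

theorem dghost_add (n : ℕ+) (x y : BigWitt R) : dghost n (x + y) = dghost n x + dghost n y := by
  rw [← map_lift x, ← map_lift y, ← map_add']
  simp only [dghost_map, ← map_add]
  refine congrArg _ (smul_cancel (i := Ring.toIntAlgebra _) n ?_)
  rw [smul_add, smul_dghost, smul_dghost, smul_dghost, ghost_add, map_add]

theorem dghost_mul (n : ℕ+) (x y : BigWitt R) :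
    dghost n (x * y) = ghost n x • dghost n y + ghost n y • dghost n x := by
  rw [← map_lift x, ← map_lift y, ← map_mul']
  simp only [dghost_map, ghost_map, ← mapΩ_smul, ← map_add]
  refine congrArg _ (smul_cancel (i := Ring.toIntAlgebra _) n ?_)
  rw [smul_dghost, ghost_mul, Derivation.leibniz, smul_add, smul_comm _ (ghost n (lift x)),
    smul_comm _ (ghost n (lift y)), smul_dghost, smul_dghost]

/-- A derivation relative to a ring homomorphism factors through the differentials. -/
theorem exists_semilinear {M : Type*} [AddCommGroup M] [Module S M] (f : R →+* S) (g : R →+ M)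
    (hg : ∀ a b, g (a * b) = f a • g b + f b • g a) :
    ∃ F : Ω[R⁄ℤ] →ₛₗ[f] M, ∀ a, F (KaehlerDifferential.D ℤ R a) = g a := by
  let _ : Module R M := Module.compHom M f
  let D : Derivation ℤ R M := Derivation.mk' g.toIntLinearMap hg
  refine ⟨{ toFun := D.liftKaehlerDifferential, map_add' := map_add _, map_smul' := fun a w => ?_ },
    fun a => D.liftKaehlerDifferential_comp_D a⟩
  exact map_smul D.liftKaehlerDifferential a w

theorem semilinear_ext {M : Type*} [AddCommGroup M] [Module S M] (f : R →+* S)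
    {F G : Ω[R⁄ℤ] →ₛₗ[f] M}
    (h : ∀ a, F (KaehlerDifferential.D ℤ R a) = G (KaehlerDifferential.D ℤ R a)) : F = G := by
  refine LinearMap.ext_on_range (KaehlerDifferential.span_range_derivation ℤ R) h

end Differentials

section FrobeniusΩ

variable {A : Type u} [CommRing A]

theorem exists_frobΩ (n : ℕ+) : ∃ F : Ω[BigWitt A⁄ℤ] →ₛₗ[(frobenius n : BigWitt A →+* BigWitt A)] Ω[BigWitt A⁄ℤ],
    ∀ a : BigWitt A, F (KaehlerDifferential.D ℤ _ a) = dghost n (delta a) := by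
  refine exists_semilinear (frobenius n)
    (⟨⟨fun a => dghost n (delta a), ?_⟩, fun a b => ?_⟩ : BigWitt A →+ Ω[BigWitt A⁄ℤ]) fun a b => ?_
  · simpa using dghost_add n (delta (0 : BigWitt A)) (delta 0)
  · simp only [map_add, dghost_add]
  · change dghost n (delta (a * b)) = _ • dghost n (delta b) + _ • dghost n (delta a)
    rw [map_mul, dghost_mul, ghost_delta, ghost_delta]

/-- The divided Frobenius on differentials: the unique `F_n`-linear map with
`F_n(da) = ∑_{e ∣ n} Δ_e(a) ^ (n / e - 1) dΔ_e(a)`. -/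
def frobΩ (n : ℕ+) : Ω[BigWitt A⁄ℤ] →ₛₗ[(frobenius n : BigWitt A →+* BigWitt A)] Ω[BigWitt A⁄ℤ] :=
  (exists_frobΩ n).choose

theorem frobΩ_D (n : ℕ+) (a : BigWitt A) :
    frobΩ n (KaehlerDifferential.D ℤ (BigWitt A) a) =
      ∑ e ∈ (n : ℕ).divisors, (delta a).coeff e.toPNat' ^ ((n : ℕ) / e - 1) •
        KaehlerDifferential.D ℤ (BigWitt A) ((delta a).coeff e.toPNat') :=
  (exists_frobΩ n).choose_spec a

/-- The element `d log [-1] = [-1]⁻¹ d[-1] = [-1] d[-1]`. -/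
def dlogNegOne (A : Type u) [CommRing A] : Ω[BigWitt A⁄ℤ] :=
  teichmuller (-1 : A) • KaehlerDifferential.D ℤ (BigWitt A) (teichmuller (-1 : A))

end FrobeniusΩ

end BigWitt

/-! ### The graded algebra `Ω̂` -/

namespace OmegaHat

/-- The relations `da ⊗ da = d log [-1] ⊗ F_2(da)`, for `a ∈ W(A)`, in the tensor algebra of the
`W(A)`-module of absolute Kähler differentials of `W(A)`. -/
inductive Rel (A : Type u) [CommRing A] : TensorAlgebra (BigWitt A) Ω[BigWitt A⁄ℤ] →
    TensorAlgebra (BigWitt A) Ω[BigWitt A⁄ℤ] → Prop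
  | of (a : BigWitt A) : Rel A
      (TensorAlgebra.ι _ (KaehlerDifferential.D ℤ (BigWitt A) a) *
        TensorAlgebra.ι _ (KaehlerDifferential.D ℤ (BigWitt A) a))
      (TensorAlgebra.ι _ (BigWitt.dlogNegOne A) *
        TensorAlgebra.ι _ (BigWitt.frobΩ 2 (KaehlerDifferential.D ℤ (BigWitt A) a)))

end OmegaHat

/-- The algebra `Ω̂`: the quotient of the tensor algebra of the `W(A)`-module `Ω_{W(A)}` by the
two-sided ideal generated by the elements `da ⊗ da - d log [-1] ⊗ F_2(da)`. -/
def OmegaHat (A : Type u) [CommRing A] : Type u := RingQuot (OmegaHat.Rel A)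

namespace OmegaHat

variable (A : Type u) [CommRing A]

instance : Ring (OmegaHat A) := inferInstanceAs (Ring (RingQuot (OmegaHat.Rel A)))

instance : Algebra (BigWitt A) (OmegaHat A) :=
  inferInstanceAs (Algebra (BigWitt A) (RingQuot (OmegaHat.Rel A)))

/-- The projection from the tensor algebra. -/
def mk : TensorAlgebra (BigWitt A) Ω[BigWitt A⁄ℤ] →ₐ[BigWitt A] OmegaHat A :=
  RingQuot.mkAlgHom (BigWitt A) (OmegaHat.Rel A)

/-- The canonical map from the Kähler differentials, onto the part of degree one. -/
def ι : Ω[BigWitt A⁄ℤ] →ₗ[BigWitt A] OmegaHat A :=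
  (mk A).toLinearMap ∘ₗ TensorAlgebra.ι (BigWitt A)

/-- The homogeneous part of degree `q`: the image of the `q`-th tensor power. -/
def gr (q : ℕ) : Submodule (BigWitt A) (OmegaHat A) := LinearMap.range (ι A) ^ q

instance : SetLike.GradedMonoid (gr A) :=
  Submodule.nat_power_gradedMonoid (LinearMap.range (ι A))

variable {A}

theorem ι_mul_ι (a : BigWitt A) :
    ι A (KaehlerDifferential.D ℤ (BigWitt A) a) * ι A (KaehlerDifferential.D ℤ (BigWitt A) a) =
      ι A (BigWitt.dlogNegOne A) *
        ι A (BigWitt.frobΩ 2 (KaehlerDifferential.D ℤ (BigWitt A) a)) := by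
  have := RingQuot.mkAlgHom_rel (BigWitt A) (Rel.of a)
  rw [map_mul, map_mul] at this
  exact this

/-- The universal property of `Ω̂`. -/
def lift {B : Type v} [Semiring B] [Algebra (BigWitt A) B] (f : Ω[BigWitt A⁄ℤ] →ₗ[BigWitt A] B)
    (hf : ∀ a : BigWitt A, f (KaehlerDifferential.D ℤ (BigWitt A) a) *
        f (KaehlerDifferential.D ℤ (BigWitt A) a) = f (BigWitt.dlogNegOne A) *
        f (BigWitt.frobΩ 2 (KaehlerDifferential.D ℤ (BigWitt A) a))) :
    OmegaHat A →ₐ[BigWitt A] B :=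
  RingQuot.liftAlgHom (BigWitt A) ⟨TensorAlgebra.lift (BigWitt A) f, by
    rintro _ _ ⟨a⟩
    simpa using hf a⟩

theorem lift_ι {B : Type v} [Semiring B] [Algebra (BigWitt A) B] (f : Ω[BigWitt A⁄ℤ] →ₗ[BigWitt A] B)
    (hf) (w : Ω[BigWitt A⁄ℤ]) : lift f hf (ι A w) = f w := by
  have := RingQuot.liftAlgHom_mkAlgHom_apply (BigWitt A) (TensorAlgebra.lift (BigWitt A) f)
    (s := Rel A) (by rintro _ _ ⟨a⟩; simpa using hf a) (TensorAlgebra.ι _ w)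
  exact this.trans (TensorAlgebra.lift_ι_apply _ _)

theorem algHom_ext {B : Type v} [Semiring B] [Algebra (BigWitt A) B] {f g : OmegaHat A →ₐ[BigWitt A] B}
    (h : ∀ w, f (ι A w) = g (ι A w)) : f = g := by
  refine RingQuot.ringQuot_ext' (BigWitt A) f g (TensorAlgebra.hom_ext (LinearMap.ext h))

open scoped DirectSum

variable (A)

/-- The map `ι` with values in the direct sum of the homogeneous parts. -/
def gradedι : Ω[BigWitt A⁄ℤ] →ₗ[BigWitt A] ⨁ q : ℕ, gr A q :=
  DirectSum.lof (BigWitt A) ℕ (fun q => gr A q) 1 ∘ₗ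
    (ι A).codRestrict _ fun w => by
      simpa only [gr, pow_one] using LinearMap.mem_range_self _ w

theorem gradedι_apply (w : Ω[BigWitt A⁄ℤ]) :
    gradedι A w = DirectSum.of (fun q : ℕ => gr A q) 1
      ⟨ι A w, by simpa only [gr, pow_one] using LinearMap.mem_range_self _ w⟩ := rfl

/-- The algebra homomorphism from `Ω̂` to the direct sum of its homogeneous parts. -/
def gradedLift : OmegaHat A →ₐ[BigWitt A] ⨁ q : ℕ, gr A q :=
  lift (gradedι A) fun a => by
    simp only [gradedι_apply, DirectSum.of_mul_of]
    exact congrArg _ (Subtype.ext (ι_mul_ι a))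

theorem gradedLift_eq (q : ℕ) (x : gr A q) :
    gradedLift A x = DirectSum.of (fun q => gr A q) q x := by
  obtain ⟨x, hx⟩ := x
  dsimp only [Subtype.coe_mk]
  induction hx using Submodule.pow_induction_on_left' with
  | algebraMap => simp_rw [AlgHom.commutes, DirectSum.algebraMap_apply]; rfl
  | add _ _ _ _ _ ihx ihy => simp_rw [map_add, ihx, ihy, ← map_add]; rfl
  | mem_mul _ hm _ _ _ ih =>
      obtain ⟨_, rfl⟩ := hm
      simp_rw [map_mul, ih, gradedLift, lift_ι, gradedι_apply, DirectSum.of_mul_of]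
      exact DirectSum.of_eq_of_gradedMonoid_eq (Sigma.subtype_ext (add_comm _ _) rfl)

/-- `Ω̂` is the direct sum of its homogeneous parts. -/
instance : GradedAlgebra (gr A) :=
  GradedAlgebra.ofAlgHom _ (gradedLift A)
    (algHom_ext fun w => by
      simp only [AlgHom.comp_apply, AlgHom.id_apply]
      rw [gradedLift, lift_ι, gradedι_apply, DirectSum.coeAlgHom_of])
    (gradedLift_eq A)

variable {A}

/-- Graded derivations of `Ω̂`: additive maps of degree one with
`d(x y) = dx y + (-1) ^ q x dy` for `x` of degree `q`. -/
structure IsGradedDerivation (d : OmegaHat A →+ OmegaHat A) : Prop where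
  map_mem : ∀ (q : ℕ), ∀ x ∈ gr A q, d x ∈ gr A (q + 1)
  leibniz : ∀ (q : ℕ), ∀ x ∈ gr A q, ∀ y, d (x * y) = d x * y + (-1) ^ q * (x * d y)

/-- Graded derivations of `Ω̂` that extend `d : W(A) → Ω_{W(A)}` and satisfy
`ddω = d log [-1] dω`. -/
structure IsExteriorDerivative (d : OmegaHat A →+ OmegaHat A) : Prop
    extends IsGradedDerivation d where
  map_algebraMap : ∀ a : BigWitt A,
    d (algebraMap (BigWitt A) (OmegaHat A) a) = ι A (KaehlerDifferential.D ℤ (BigWitt A) a)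
  map_map : ∀ w, d (d w) = ι A (BigWitt.dlogNegOne A) * d w

/-- Homomorphisms of graded rings that are given by `F_n : W(A) → W(A)` and
`F_n : Ω_{W(A)} → Ω_{W(A)}` in degrees zero and one. -/
structure IsFrobenius (n : ℕ+) (F : OmegaHat A →+* OmegaHat A) : Prop where
  map_mem : ∀ (q : ℕ), ∀ x ∈ gr A q, F x ∈ gr A q
  map_algebraMap : ∀ a : BigWitt A, F (algebraMap (BigWitt A) (OmegaHat A) a) =
    algebraMap (BigWitt A) (OmegaHat A) (BigWitt.frobenius n a)
  map_ι : ∀ w : Ω[BigWitt A⁄ℤ], F (ι A w) = ι A (BigWitt.frobΩ n w)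

end OmegaHat

end

/-! Everything rests on `2 dlog[-1] = 0`, obtained by differentiating `[-1]² = 1`
(`two_smul_dlogNegOne`). The right side of the relation `da·da = dlog[-1]·F_2(da)` is additive in
`a`, so polarisation makes exact one-forms, hence all one-forms, anticommute (`ι_anticomm`); part 1
follows by induction on degrees. Since `F_2(a)` is `a²` up to an element `2b`, and `dlog[-1]` kills
`2b`, the relation persists for all one-forms (`ι_mul_self`).

The derivation is the upper right entry of a ring homomorphism `x ↦ (x̄, dx; 0, x)` into triangular
matrices, where `x̄` is the grading involution; multiplicativity of this map is the graded Leibniz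
rule. By the universal property it is enough to prescribe the matrices of `a` and `da`, the entry
for `d(da)` being forced to be `dlog[-1]·da`, and to check the defining relation. Its upper entries
vanish on both sides, because `dlog[-1]` and `F_2(da)` are closed and `2 dlog[-1] = 0`
(`exists_triangularHom`). The formula for `dd` is then verified on generators.

For `F_n`, the relation must be preserved. This follows from `F_n(dlog[-1]) = dlog[-1]`, from
`ι_mul_self` applied to `F_n(da)`, and from `F_m F_n = F_{mn}` on one-forms (`frobΩ_frobΩ`), which
combines coassociativity of `Δ` with the chain rule for divided differentials of ghost components.
The identity `dF_n = nF_n d` holds in degree zero because `n` times the divided differential is the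
differential of the ghost component. On exact one-forms it is checked for odd `n` term by term and
for `n = 2` because both sides vanish; composing Frobenii gives all `n`. -/

noncomputable section

/-! ### Coassociativity of `Δ`, composition of Frobenii on one-forms, and `dlog[-1]`. -/

namespace BigWitt

variable {A : Type u} [CommRing A]

theorem delta_natural {B : Type v} [CommRing B] (f : A →+* B) (x : BigWitt A) :
    map (mapHom f) (delta x) = delta (map f x) := map_deltaFun f x

/-- Over a polynomial ring ghost components separate points, and the `k`-th one is `F_{kn}(x)` on
both sides; naturality transports the identity to any ring. -/
theorem delta_frobenius (n : ℕ+) (x : BigWitt A) :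
    delta (frobenius n x) = frobenius n (delta x) := by
  rw [← map_lift x, ← map_frobenius, ← delta_natural, ← delta_natural, ← map_frobenius]
  refine congrArg _ (ext_ghost_mv₂ fun k => ?_)
  rw [ghost_delta, ghost_frobenius, ghost_delta, frobenius_frobenius, mul_comm]

/-- The map `Δ` is coassociative. -/
theorem delta_delta (x : BigWitt A) : map delta (delta x) = delta (delta x) := by
  have hn : ∀ {B : Type u} [CommRing B] (f : B →+* A) (y : BigWitt B),
      map delta (delta y) = delta (delta y) →
        map delta (delta (map f y)) = delta (delta (map f y)) := by
    intro B _ f y h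
    rw [← delta_natural, ← delta_natural, ← h, map_map]
    have : delta.comp (mapHom f) = (mapHom (mapHom f)).comp (delta (A := B)) :=
      RingHom.ext fun z => (delta_natural f z).symm
    rw [this]
    rfl
  rw [← map_lift x]
  -- The outermost ghost components of the two sides are `Δ(F_k y)` and `F_k(Δ y)`.
  refine hn _ _ (ext_ghost (torsionFree (torsionFree (torsionFree_mvPolynomial A))) fun k => ?_)
  rw [ghost_map, ghost_delta, ghost_delta, delta_frobenius]

theorem delta_teichmuller (a : A) : delta (teichmuller a) = teichmuller (teichmuller a) := by
  -- Reduces to a variable over `ℤ[A]`, where two layers of ghost components, both equal to powers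
  -- of the variable, decide equality.
  have h : a = cover A (MvPolynomial.X a) := by simp [cover]
  rw [h, ← map_teichmuller, ← delta_natural]
  have h2 : ∀ b : MvPolynomial A ℤ, teichmuller (map (cover A) (teichmuller b))
      = map (mapHom (cover A)) (teichmuller (teichmuller b)) :=
    fun b => (map_teichmuller (mapHom (cover A)) _).symm
  rw [h2]
  refine congrArg _ (ext_ghost_mv₂ fun k => ext_ghost_mv fun m => ?_)
  rw [ghost_delta, ghost_frobenius, ghost_teichmuller, ghost_teichmuller]
  change _ = ghostHom m _
  rw [map_pow]
  change _ = (ghost m _) ^ _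
  rw [ghost_teichmuller, ← pow_mul, PNat.mul_coe, mul_comm]

theorem frobΩ_D_eq (n : ℕ+) (a : BigWitt A) :
    frobΩ n (KaehlerDifferential.D ℤ (BigWitt A) a) = dghost n (delta a) :=
  frobΩ_D n a

/-- The divided differential of `w_{mn} = w_n ∘ W(w_m) ∘ Δ`, computed by the chain rule. -/
theorem sum_dghost_delta {R : Type u} [CommRing R] (m n : ℕ+) (x : BigWitt R) :
    ∑ e ∈ (n : ℕ).divisors, ghost m ((delta x).coeff e.toPNat') ^ ((n : ℕ) / e - 1) •
      dghost m ((delta x).coeff e.toPNat') = dghost (m * n) x := by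
  have hn : ∀ {B : Type u} [CommRing B] (f : B →+* R) (y : BigWitt B),
      mapΩ f (∑ e ∈ (n : ℕ).divisors, ghost m ((delta y).coeff e.toPNat') ^ ((n : ℕ) / e - 1) •
        dghost m ((delta y).coeff e.toPNat')) =
      ∑ e ∈ (n : ℕ).divisors, ghost m ((delta (map f y)).coeff e.toPNat') ^ ((n : ℕ) / e - 1) •
        dghost m ((delta (map f y)).coeff e.toPNat') := by
    intro B _ f y
    rw [← delta_natural, map_sum]
    refine Finset.sum_congr rfl fun e _ => ?_
    change _ = ghost m (map f ((delta y).coeff e.toPNat')) ^ ((n : ℕ) / e - 1) •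
      dghost m (map f ((delta y).coeff e.toPNat'))
    rw [ghost_map, dghost_map, mapΩ_smul, map_pow]
  rw [← map_lift x, ← hn, dghost_map]
  -- The differentials of a polynomial ring are free, so it suffices to compare after multiplication
  -- by `mn`: the factor `m` turns the sum into the divided differential of `W(w_m)(Δ x)`, and `n`
  -- then gives `d w_{mn}(x)`.
  refine congrArg _ (smul_cancel (i := Ring.toIntAlgebra _) (m * n) ?_)
  have h : ((m : ℕ) : MvPolynomial R ℤ) • ∑ e ∈ (n : ℕ).divisors,
      ghost m ((delta (lift x)).coeff e.toPNat') ^ ((n : ℕ) / e - 1) •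
        dghost m ((delta (lift x)).coeff e.toPNat') =
      dghost n (map (ghostHom m) (delta (lift x))) := by
    rw [Finset.smul_sum, dghost]
    refine Finset.sum_congr rfl fun e _ => ?_
    rw [smul_comm, smul_dghost]
    rfl
  rw [smul_dghost, PNat.mul_coe, Nat.cast_mul, mul_comm, mul_smul, h, smul_dghost, ghost_map,
    ghost_delta]
  change KaehlerDifferential.D ℤ _ (ghost m _) = _
  rw [ghost_frobenius, mul_comm]

/-- On `da`, semilinearity expresses the left side through `Δ(Δ_e(a))`. By coassociativity this is
the `e`-th component of `Δ(Δ(a))`, so the chain rule `sum_dghost_delta` applies to the vector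
`Δ(a)`. -/
theorem frobΩ_frobΩ (m n : ℕ+) (w : Ω[BigWitt A⁄ℤ]) :
    frobΩ m (frobΩ n w) = frobΩ (m * n) w := by
  induction (KaehlerDifferential.span_range_derivation ℤ (BigWitt A)).ge
    (Submodule.mem_top (x := w)) using Submodule.span_induction with
  | zero => simp
  | add _ _ _ _ h1 h2 => simp only [map_add, h1, h2]
  | smul a _ _ h => simp only [map_smulₛₗ, h, frobenius_frobenius]
  | mem _ h =>
    obtain ⟨a, rfl⟩ := h
    rw [frobΩ_D, frobΩ_D_eq, map_sum, ← sum_dghost_delta, ← delta_delta]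
    refine Finset.sum_congr rfl fun e _ => ?_
    rw [map_smulₛₗ, frobΩ_D_eq, map_pow, ← ghost_delta]
    rfl

theorem frobenius_teichmuller (n : ℕ+) (a : A) :
    frobenius n (teichmuller a) = teichmuller a ^ (n : ℕ) := by
  rw [← ghost_delta, delta_teichmuller, ghost_teichmuller]

theorem frobΩ_D_teichmuller (n : ℕ+) (a : A) :
    frobΩ n (KaehlerDifferential.D ℤ (BigWitt A) (teichmuller a)) =
      teichmuller a ^ ((n : ℕ) - 1) • KaehlerDifferential.D ℤ (BigWitt A) (teichmuller a) := by
  rw [frobΩ_D, delta_teichmuller, Finset.sum_eq_single 1]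
  · simp [teichmuller, show Nat.toPNat' 1 = 1 from rfl]
  · intro e he h1
    have h2 : e.toPNat' ≠ 1 := fun h => h1 (by
      rw [← PNat.toPNat'_coe (Nat.pos_of_mem_divisors he), h]; rfl)
    -- The power can be `0 ^ 0` when `e = n`; the summand vanishes in any case because `d0 = 0`.
    simp [teichmuller, h2]
  · simp

theorem teichmuller_neg_one_sq : teichmuller (-1 : A) * teichmuller (-1 : A) = 1 := by
  have h : (-1 : A) = Int.castRingHom A (-1) := by simp
  rw [h, ← map_teichmuller, ← map_mul', ← map_one' (Int.castRingHom A)]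
  refine congrArg _ (ext_ghost (fun n hn a h => ?_) fun n => ?_)
  · exact (mul_eq_zero.1 h).resolve_left (Nat.cast_ne_zero.2 hn)
  · rw [ghost_mul, ghost_teichmuller, ghost_one, ← mul_pow]; simp

theorem D_teichmuller_neg_one :
    KaehlerDifferential.D ℤ (BigWitt A) (teichmuller (-1)) =
      teichmuller (-1 : A) • dlogNegOne A := by
  rw [dlogNegOne, smul_smul, teichmuller_neg_one_sq, one_smul]

/-- Differentiate `[-1]² = 1`. This is why signs and even multiples in front of `dlog[-1]` never
matter. -/
theorem two_smul_dlogNegOne : dlogNegOne A + dlogNegOne A = 0 := by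
  have := congrArg (KaehlerDifferential.D ℤ (BigWitt A)) (teichmuller_neg_one_sq (A := A))
  rwa [Derivation.leibniz, Derivation.map_one_eq_zero] at this

theorem frobΩ_dlogNegOne (n : ℕ+) : frobΩ n (dlogNegOne A) = dlogNegOne A := by
  -- The total exponent `2n - 1` is odd.
  have h : teichmuller (-1 : A) ^ (n : ℕ) * teichmuller (-1 : A) ^ ((n : ℕ) - 1)
      = teichmuller (-1 : A) := by
    obtain ⟨k, hk⟩ := Nat.exists_eq_add_of_lt n.pos
    rw [hk, zero_add, Nat.add_sub_cancel, pow_succ, mul_right_comm, ← mul_pow,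
      teichmuller_neg_one_sq, one_pow, one_mul]
  rw [dlogNegOne, map_smulₛₗ, frobenius_teichmuller, frobΩ_D_teichmuller, smul_smul, h]

theorem frobenius_one (a : BigWitt A) : frobenius 1 a = a := by
  rw [← map_lift a, ← map_frobenius]
  exact congrArg _ (ext_ghost_mv fun k => by rw [ghost_frobenius, one_mul])

theorem delta_coeff_one (a : BigWitt A) : (delta a).coeff 1 = a := by
  have h := ghost_delta 1 a
  rw [frobenius_one] at h
  simpa [ghost, show Nat.toPNat' 1 = 1 from rfl] using h

theorem frobΩ_two_D (a : BigWitt A) : frobΩ 2 (KaehlerDifferential.D ℤ (BigWitt A) a) =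
    a • KaehlerDifferential.D ℤ (BigWitt A) a +
      KaehlerDifferential.D ℤ (BigWitt A) ((delta a).coeff 2) := by
  rw [frobΩ_D, PNat.val_ofNat, Nat.Prime.divisors Nat.prime_two, Finset.sum_pair (by norm_num),
    show Nat.toPNat' 1 = 1 from rfl, show Nat.toPNat' 2 = 2 from rfl, delta_coeff_one]
  simp

/-- This is `w_2(Δ(a)) = Δ_1(a)² + 2Δ_2(a)`, with `Δ_1(a) = a`. -/
theorem exists_frobenius_two (a : BigWitt A) : ∃ b, frobenius 2 a = a * a + (b + b) := by
  refine ⟨(delta a).coeff 2, ?_⟩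
  rw [← ghost_delta, ghost, PNat.val_ofNat, Nat.Prime.divisors Nat.prime_two,
    Finset.sum_pair (by norm_num), show Nat.toPNat' 1 = 1 from rfl,
    show Nat.toPNat' 2 = 2 from rfl, delta_coeff_one]
  simp [pow_two, two_mul]

end BigWitt

/-! ### Generators and universal properties of `Ω̂`. -/

namespace OmegaHat

open BigWitt KaehlerDifferential

variable {A : Type u} [CommRing A]

/-- The ring `Ω̂` is generated by its elements of degree zero and the exact one-forms. -/
theorem induction {P : OmegaHat A → Prop}
    (algebraMap : ∀ a, P (algebraMap (BigWitt A) (OmegaHat A) a))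
    (add : ∀ x y, P x → P y → P (x + y))
    (smul : ∀ (a : BigWitt A) x, P x → P (a • x))
    (D_mul : ∀ (a : BigWitt A) x, P x → P (ι A (D ℤ (BigWitt A) a) * x))
    (x : OmegaHat A) : P x := by
  have hw : ∀ (w : Ω[BigWitt A⁄ℤ]) (y), P y → P (ι A w * y) := by
    intro w y hy
    induction (span_range_derivation ℤ (BigWitt A)).ge
      (Submodule.mem_top (x := w)) using Submodule.span_induction with
    | zero =>
      rw [map_zero, zero_mul]
      simpa using algebraMap 0
    | add _ _ _ _ h1 h2 =>
      rw [map_add, add_mul]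
      exact add _ _ h1 h2
    | smul a _ _ h =>
      rw [map_smul, smul_mul_assoc]
      exact smul _ _ h
    | mem _ h =>
      obtain ⟨a, rfl⟩ := h
      exact D_mul _ _ hy
  obtain ⟨t, rfl⟩ := RingQuot.mkAlgHom_surjective (BigWitt A) (Rel A) x
  -- `P` is only assumed stable under left multiplication by generators, so the induction over the
  -- tensor algebra proves stability under multiplication by `t`; the claim is the case `y = 1`.
  have ht : ∀ y, P y → P (mk A t * y) := by
    induction t using TensorAlgebra.induction with
    | algebraMap a =>
      intro y hy
      rw [AlgHom.commutes, ← Algebra.smul_def]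
      exact smul _ _ hy
    | ι w => exact hw w
    | mul s t hs ht =>
      intro y hy
      rw [map_mul, mul_assoc]
      exact hs _ (ht _ hy)
    | add s t hs ht =>
      intro y hy
      rw [map_add, add_mul]
      exact add _ _ (hs _ hy) (ht _ hy)
  have := ht 1 (by simpa using algebraMap 1)
  rwa [mul_one] at this

/-- A ring homomorphism on `Ω̂` is determined by its values in degrees zero and one. -/
theorem ringHom_ext {B : Type v} [Ring B] {f g : OmegaHat A →+* B}
    (h0 : ∀ a, f (algebraMap (BigWitt A) (OmegaHat A) a) = g (algebraMap _ _ a))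
    (h1 : ∀ w, f (ι A w) = g (ι A w)) : f = g := by
  refine RingHom.ext fun x => ?_
  induction x using induction with
  | algebraMap a => exact h0 a
  | add x y hx hy => rw [map_add, map_add, hx, hy]
  | smul a x hx => rw [Algebra.smul_def, map_mul, map_mul, hx, h0]
  | D_mul a x hx => rw [map_mul, map_mul, hx, h1]

/-- The universal property of `Ω̂` for ring homomorphisms that are semilinear over a given
homomorphism from `W(A)` to the center. -/
theorem exists_ringHom {B : Type v} [Ring B] (φ : BigWitt A →+* B)
    (hφ : ∀ a b, φ a * b = b * φ a) (f : Ω[BigWitt A⁄ℤ] →+ B)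
    (hf : ∀ (a : BigWitt A) w, f (a • w) = φ a * f w)
    (hr : ∀ a : BigWitt A, f (D ℤ (BigWitt A) a) * f (D ℤ (BigWitt A) a) =
      f (dlogNegOne A) * f (frobΩ 2 (D ℤ (BigWitt A) a))) :
    ∃ F : OmegaHat A →+* B,
      (∀ a, F (algebraMap (BigWitt A) (OmegaHat A) a) = φ a) ∧ ∀ w, F (ι A w) = f w := by
  let _ : Algebra (BigWitt A) B := φ.toAlgebra' hφ
  let f' : Ω[BigWitt A⁄ℤ] →ₗ[BigWitt A] B := { f with map_smul' := hf }
  exact ⟨(lift f' hr : OmegaHat A →+* B), fun a => (lift f' hr).commutes a, lift_ι f' hr⟩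

/-- The universal property of the differentials for derivations with values in a ring over a given
homomorphism from `W(A)` to the center. -/
theorem exists_addHom {R : Type u} [CommRing R] {B : Type v} [Ring B] (φ : R →+* B)
    (hφ : ∀ a b, φ a * b = b * φ a) (g : R →+ B)
    (hg : ∀ a b, g (a * b) = φ a * g b + φ b * g a) :
    ∃ f : Ω[R⁄ℤ] →+ B, (∀ (a : R) w, f (a • w) = φ a * f w) ∧ ∀ a, f (D ℤ R a) = g a := by
  let _ : Algebra R B := φ.toAlgebra' hφ
  obtain ⟨F, hF⟩ := exists_semilinear (RingHom.id R) g hg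
  exact ⟨F.toAddMonoidHom, fun a w => F.map_smul a w, hF⟩

/-! ### Anticommutation and squares of one-forms. -/

section Relations

/-- Polarisation: in the relation for `a + b` the right side is additive, so the cross terms on the
left cancel. -/
theorem ι_D_anticomm (a b : BigWitt A) :
    ι A (D ℤ (BigWitt A) a) * ι A (D ℤ (BigWitt A) b) =
      -(ι A (D ℤ (BigWitt A) b) * ι A (D ℤ (BigWitt A) a)) := by
  have h := ι_mul_ι (a + b)
  simp only [map_add, mul_add, add_mul, ι_mul_ι] at h
  rw [eq_neg_iff_add_eq_zero]
  have h2 := sub_eq_zero.2 h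
  rw [← h2]
  abel

theorem ι_anticomm (v w : Ω[BigWitt A⁄ℤ]) : ι A v * ι A w = -(ι A w * ι A v) := by
  induction (span_range_derivation ℤ (BigWitt A)).ge
    (Submodule.mem_top (x := v)) using Submodule.span_induction with
  | zero => simp
  | add _ _ _ _ h1 h2 => rw [map_add, add_mul, mul_add, h1, h2, neg_add]
  | smul a _ _ h => rw [map_smul, smul_mul_assoc, h, mul_smul_comm, smul_neg]
  | mem _ h =>
    obtain ⟨a, rfl⟩ := h
    induction (span_range_derivation ℤ (BigWitt A)).ge
      (Submodule.mem_top (x := w)) using Submodule.span_induction with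
    | zero => simp
    | add _ _ _ _ h1 h2 => rw [map_add, add_mul, mul_add, h1, h2, neg_add]
    | smul a _ _ h => rw [map_smul, smul_mul_assoc, mul_smul_comm, h, smul_neg]
    | mem _ h =>
      obtain ⟨b, rfl⟩ := h
      exact ι_D_anticomm a b

theorem dlog_add_dlog : ι A (dlogNegOne A) + ι A (dlogNegOne A) = 0 := by
  rw [← map_add, two_smul_dlogNegOne, map_zero]

theorem neg_dlog : -ι A (dlogNegOne A) = ι A (dlogNegOne A) :=
  neg_eq_of_add_eq_zero_left dlog_add_dlog

theorem ι_mul_dlog (w : Ω[BigWitt A⁄ℤ]) :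
    ι A w * ι A (dlogNegOne A) = ι A (dlogNegOne A) * ι A w := by
  rw [ι_anticomm, ← neg_mul, neg_dlog]

theorem dlog_mul_add_self (x : OmegaHat A) :
    ι A (dlogNegOne A) * x + ι A (dlogNegOne A) * x = 0 := by
  rw [← add_mul, dlog_add_dlog, zero_mul]

/-- Extends the defining relation beyond exact forms, as needed for `F_n(da)`, which is not given as
an exact form. -/
theorem ι_mul_self (w : Ω[BigWitt A⁄ℤ]) :
    ι A w * ι A w = ι A (dlogNegOne A) * ι A (frobΩ 2 w) := by
  induction (span_range_derivation ℤ (BigWitt A)).ge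
    (Submodule.mem_top (x := w)) using Submodule.span_induction with
  | zero => simp
  | add v w _ _ h1 h2 =>
    rw [map_add, map_add, map_add, add_mul, mul_add, mul_add, mul_add, h1, h2, ι_anticomm v w]
    abel
  | smul a w _ h =>
    -- The square contributes `a²`, while semilinearity of `F_2` contributes `F_2(a) = a² + 2b`; the
    -- excess `2b` dies against `dlog[-1]`.
    obtain ⟨b, hb⟩ := exists_frobenius_two a
    rw [map_smul, smul_mul_assoc, mul_smul_comm, h, map_smulₛₗ, hb, map_smul, add_smul, add_smul,
      mul_smul, mul_add, mul_add, mul_smul_comm, mul_smul_comm,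
      dlog_mul_add_self, add_zero]
  | mem _ h =>
    obtain ⟨a, rfl⟩ := h
    exact ι_mul_ι a

end Relations

/-! ### Anti-symmetry and the grading involution. -/

section Grading

theorem ι_mem (w : Ω[BigWitt A⁄ℤ]) : ι A w ∈ gr A 1 := by
  simpa only [gr, pow_one] using LinearMap.mem_range_self _ w

theorem algebraMap_mem (a : BigWitt A) : algebraMap (BigWitt A) (OmegaHat A) a ∈ gr A 0 := by
  simp [gr]

theorem ι_mul_mem {q : ℕ} (w : Ω[BigWitt A⁄ℤ]) {x : OmegaHat A} (hx : x ∈ gr A q) :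
    ι A w * x ∈ gr A (q + 1) :=
  add_comm 1 q ▸ SetLike.mul_mem_graded (ι_mem w) hx

/-- Homogeneous elements are sums of products of one-forms. -/
theorem gr_induction {P : ℕ → OmegaHat A → Prop}
    (algebraMap : ∀ a, P 0 (algebraMap (BigWitt A) (OmegaHat A) a))
    (add : ∀ q x y, P q x → P q y → P q (x + y))
    (ι_mul : ∀ q w x, x ∈ gr A q → P q x → P (q + 1) (ι A w * x))
    {q : ℕ} {x : OmegaHat A} (hx : x ∈ gr A q) : P q x := by
  induction hx using Submodule.pow_induction_on_left' with
  | algebraMap a => exact algebraMap a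
  | add x y i _ _ hx hy => exact add i x y hx hy
  | mem_mul _ hm i x hx ih =>
    obtain ⟨w, rfl⟩ := hm
    exact ι_mul i w x hx ih

theorem ι_mul_homogeneous (w : Ω[BigWitt A⁄ℤ]) {q : ℕ} {x : OmegaHat A} (hx : x ∈ gr A q) :
    ι A w * x = (-1) ^ q * (x * ι A w) := by
  refine gr_induction (P := fun q x => ι A w * x = (-1) ^ q * (x * ι A w)) (fun a => ?_)
    (fun q x y hx hy => ?_) (fun q v x _ hx => ?_) hx
  · rw [pow_zero, one_mul, Algebra.commutes]
  · rw [mul_add, add_mul, mul_add, hx, hy]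
  · rw [← mul_assoc, ι_anticomm, neg_mul, mul_assoc, hx, pow_succ']
    rcases neg_one_pow_eq_or (OmegaHat A) q with h | h <;> rw [h] <;> noncomm_ring

/-- The algebra `Ω̂` is anti-symmetric. -/
theorem mul_comm_homogeneous {p q : ℕ} {x y : OmegaHat A} (hx : x ∈ gr A p) (hy : y ∈ gr A q) :
    x * y = (-1) ^ (p * q) * (y * x) := by
  refine gr_induction (P := fun p x => x * y = (-1) ^ (p * q) * (y * x)) (fun a => ?_)
    (fun p x x' hx hx' => ?_) (fun p w x _ hx => ?_) hx
  · rw [zero_mul, pow_zero, one_mul, Algebra.commutes]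
  · rw [mul_add, add_mul, mul_add, hx, hx']
  · rw [mul_assoc, hx, add_mul, one_mul, pow_add]
    have := ι_mul_homogeneous w hy
    rcases neg_one_pow_eq_or (OmegaHat A) (p * q) with h | h <;> rw [h] <;>
      simp [← mul_assoc, this]

/-- The grading involution of `Ω̂`. -/
def invol (A : Type u) [CommRing A] : OmegaHat A →ₐ[BigWitt A] OmegaHat A :=
  -- Both sides of the relation are quadratic, so the change of sign preserves it.
  lift (-ι A) fun a => by simp [ι_mul_ι]

theorem invol_ι (w : Ω[BigWitt A⁄ℤ]) : invol A (ι A w) = -ι A w := lift_ι _ _ w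

theorem invol_homogeneous {q : ℕ} {x : OmegaHat A} (hx : x ∈ gr A q) :
    invol A x = (-1) ^ q * x := by
  refine gr_induction (P := fun q x => invol A x = (-1) ^ q * x) (fun a => ?_)
    (fun q x y hx hy => ?_) (fun q v x _ hx => ?_) hx
  · rw [AlgHom.commutes, pow_zero, one_mul]
  · rw [map_add, mul_add, hx, hy]
  · rw [map_mul, invol_ι, hx, pow_succ']
    rcases neg_one_pow_eq_or (OmegaHat A) q with h | h <;> rw [h] <;> noncomm_ring

/-- A form of anti-symmetry without homogeneity, suited to the matrix products below. -/
theorem invol_mul_ι (w : Ω[BigWitt A⁄ℤ]) (x : OmegaHat A) : invol A x * ι A w = ι A w * x := by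
  induction x using induction with
  | algebraMap a => rw [AlgHom.commutes, Algebra.commutes]
  | add x y hx hy => rw [map_add, mul_add, add_mul, hx, hy]
  | smul a x hx => rw [map_smul, smul_mul_assoc, hx, mul_smul_comm]
  | D_mul a x hx =>
    rw [map_mul, invol_ι, mul_assoc, hx, ← mul_assoc, ← mul_assoc, ι_anticomm w, neg_mul]

end Grading

end OmegaHat

namespace OmegaHat

open BigWitt KaehlerDifferential

variable {A : Type u} [CommRing A]

/-! ### The derivation, through triangular matrices. -/

section Derivative

/-- The ring of matrices `(x̄, z; 0, x)`, with `x̄` the image of `x` by the grading involution.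
A section of the projection to the lower right entry is a graded derivation. -/
def triangular (A : Type u) [CommRing A] : Subring (Matrix (Fin 2) (Fin 2) (OmegaHat A)) where
  carrier := {M | M 1 0 = 0 ∧ M 0 0 = invol A (M 1 1)}
  mul_mem' := by
    rintro M N ⟨h1, h2⟩ ⟨h3, h4⟩
    simp [Matrix.mul_apply, Fin.sum_univ_two, h1, h2, h3, h4]
  one_mem' := by simp
  add_mem' := by
    rintro M N ⟨h1, h2⟩ ⟨h3, h4⟩
    simp [h1, h2, h3, h4]
  zero_mem' := by simp
  neg_mem' := by
    rintro M ⟨h1, h2⟩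
    simp [h1, h2]

/-- The matrix `(x̄, z; 0, x)`. -/
def triangularMk (x z : OmegaHat A) : triangular A :=
  ⟨!![invol A x, z; 0, x], by simp [triangular]⟩

/-- The upper right entry. -/
def upper (M : triangular A) : OmegaHat A := M.1 0 1

/-- The lower right entry. -/
def lower (M : triangular A) : OmegaHat A := M.1 1 1

theorem triangular_ext {M N : triangular A} (h1 : lower M = lower N) (h2 : upper M = upper N) :
    M = N := by
  obtain ⟨M, hM1, hM2⟩ := M
  obtain ⟨N, hN1, hN2⟩ := N
  refine Subtype.ext (Matrix.ext fun i j => ?_)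
  change M 1 1 = N 1 1 at h1
  change M 0 1 = N 0 1 at h2
  fin_cases i <;> fin_cases j <;> simp_all

theorem lower_mk (x z : OmegaHat A) : lower (triangularMk x z) = x := by
  simp [lower, triangularMk]

theorem upper_mk (x z : OmegaHat A) : upper (triangularMk x z) = z := by
  simp [upper, triangularMk]

theorem lower_add (M N : triangular A) : lower (M + N) = lower M + lower N := rfl

theorem upper_add (M N : triangular A) : upper (M + N) = upper M + upper N := rfl

theorem lower_mul (M N : triangular A) : lower (M * N) = lower M * lower N := by
  have h : M.1 1 0 = 0 := M.2.1
  simp [lower, Matrix.mul_apply, Fin.sum_univ_two, h]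

theorem upper_mul (M N : triangular A) :
    upper (M * N) = invol A (lower M) * upper N + upper M * lower N := by
  have h : M.1 0 0 = invol A (M.1 1 1) := M.2.2
  simp [upper, lower, Matrix.mul_apply, Fin.sum_univ_two, h]

theorem lower_one : lower (1 : triangular A) = 1 := by simp [lower]

theorem upper_one : upper (1 : triangular A) = 0 := by simp [upper]

/-- The homomorphism `a ↦ (a, da; 0, a)`. -/
def triangularAlgebraMap (A : Type u) [CommRing A] : BigWitt A →+* triangular A where
  toFun a := triangularMk (algebraMap _ _ a) (ι A (D ℤ (BigWitt A) a))
  map_zero' := triangular_ext (by rw [lower_mk, map_zero]; rfl)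
    (by rw [upper_mk, map_zero, map_zero]; rfl)
  map_one' := triangular_ext (by rw [lower_mk, map_one, lower_one])
    (by rw [upper_mk, Derivation.map_one_eq_zero, map_zero, upper_one])
  map_add' a b := triangular_ext (by simp only [lower_add, lower_mk, map_add])
    (by simp only [upper_add, upper_mk, map_add])
  map_mul' a b := triangular_ext (by simp only [lower_mul, lower_mk, map_mul]) (by
    simp only [upper_mul, lower_mk, upper_mk, Derivation.leibniz, map_add, map_smul,
      AlgHom.commutes, Algebra.smul_def]
    rw [Algebra.commutes b])

theorem lower_triangularAlgebraMap (a : BigWitt A) :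
    lower (triangularAlgebraMap A a) = algebraMap _ _ a := lower_mk _ _

theorem upper_triangularAlgebraMap (a : BigWitt A) :
    upper (triangularAlgebraMap A a) = ι A (D ℤ (BigWitt A) a) := upper_mk _ _

/-- Centrality is what lets the universal property be used with values in matrices. In the upper
entry it amounts to `m̄·da = da·m`. -/
theorem triangularAlgebraMap_comm (a : BigWitt A) (M : triangular A) :
    triangularAlgebraMap A a * M = M * triangularAlgebraMap A a := by
  refine triangular_ext ?_ ?_
  · rw [lower_mul, lower_mul, lower_triangularAlgebraMap, Algebra.commutes]
  · rw [upper_mul, upper_mul, lower_triangularAlgebraMap, upper_triangularAlgebraMap, invol_mul_ι,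
      AlgHom.commutes, Algebra.commutes, add_comm]

/-- The map `a ↦ (-da, d log [-1] da; 0, da)`. -/
def triangularD (A : Type u) [CommRing A] : BigWitt A →+ triangular A where
  toFun a := triangularMk (ι A (D ℤ (BigWitt A) a))
    (ι A (dlogNegOne A) * ι A (D ℤ (BigWitt A) a))
  map_zero' := triangular_ext (by rw [lower_mk, map_zero, map_zero]; rfl)
    (by rw [upper_mk, map_zero, map_zero, mul_zero]; rfl)
  map_add' a b := triangular_ext (by simp only [lower_add, lower_mk, map_add])
    (by simp only [upper_add, upper_mk, map_add, mul_add])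

theorem lower_triangularD (a : BigWitt A) :
    lower (triangularD A a) = ι A (D ℤ (BigWitt A) a) := lower_mk _ _

theorem upper_triangularD (a : BigWitt A) : upper (triangularD A a) =
    ι A (dlogNegOne A) * ι A (D ℤ (BigWitt A) a) := upper_mk _ _

/-- In the upper entry, the products `da·db` and `db·da` produced by the Leibniz rule cancel by
anticommutation. -/
theorem triangularD_mul (a b : BigWitt A) : triangularD A (a * b) =
    triangularAlgebraMap A a * triangularD A b + triangularAlgebraMap A b * triangularD A a := by
  refine triangular_ext ?_ ?_
  · simp only [lower_add, lower_mul, lower_triangularAlgebraMap, lower_triangularD,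
      Derivation.leibniz, map_add, map_smul, Algebra.smul_def]
  · simp only [upper_add, upper_mul, lower_triangularAlgebraMap, lower_triangularD,
      upper_triangularAlgebraMap, upper_triangularD, Derivation.leibniz, map_add, map_smul,
      AlgHom.commutes, mul_add, ← Algebra.smul_def, mul_smul_comm]
    rw [ι_D_anticomm a b]
    abel

theorem exists_triangularHom (A : Type u) [CommRing A] :
    ∃ F : OmegaHat A →+* triangular A,
      (∀ a, F (algebraMap _ _ a) = triangularAlgebraMap A a) ∧
      ∀ a, F (ι A (D ℤ (BigWitt A) a)) = triangularD A a := by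
  obtain ⟨f, hf, hD⟩ := exists_addHom (triangularAlgebraMap A) triangularAlgebraMap_comm
    (triangularD A) triangularD_mul
  have hl : ∀ w, lower (f w) = ι A w := by
    intro w
    induction (span_range_derivation ℤ (BigWitt A)).ge
      (Submodule.mem_top (x := w)) using Submodule.span_induction with
    | zero => rw [map_zero, map_zero]; rfl
    | add _ _ _ _ h1 h2 => rw [map_add, map_add, lower_add, h1, h2]
    | smul a _ _ h =>
      rw [hf, lower_mul, lower_triangularAlgebraMap, h, map_smul, Algebra.smul_def]
    | mem _ h =>
      obtain ⟨a, rfl⟩ := h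
      rw [hD, lower_triangularD]
  -- The entry is `[-1]·dlog[-1]·d[-1] + d[-1]·d[-1]`, and each summand equals `dlog[-1]·dlog[-1]`.
  have hdlog : upper (f (dlogNegOne A)) = 0 := by
    have h : ι A (D ℤ (BigWitt A) (teichmuller (-1))) * ι A (D ℤ (BigWitt A) (teichmuller (-1))) =
        ι A (dlogNegOne A) * ι A (dlogNegOne A) := by
      rw [D_teichmuller_neg_one, map_smul, smul_mul_smul_comm, teichmuller_neg_one_sq, one_smul]
    have h2 : algebraMap (BigWitt A) (OmegaHat A) (teichmuller (-1)) *
        ι A (D ℤ (BigWitt A) (teichmuller (-1))) = ι A (dlogNegOne A) := by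
      rw [← Algebra.smul_def, ← map_smul, dlogNegOne]
    rw [dlogNegOne, hf, hD, upper_mul, lower_triangularAlgebraMap, AlgHom.commutes,
      upper_triangularAlgebraMap, lower_triangularD, upper_triangularD, h, ← mul_assoc,
      Algebra.commutes, mul_assoc, h2, dlog_mul_add_self]
  -- With `F_2(da) = a da + dΔ_2(a)`, the entry is `da·da + dlog[-1]·F_2(da)`, that is, twice
  -- `dlog[-1]·F_2(da)`.
  have htwo : ∀ a, upper (f (frobΩ 2 (D ℤ (BigWitt A) a))) = 0 := by
    intro a
    rw [frobΩ_two_D, map_add, hf, hD, hD, upper_add, upper_mul, upper_triangularD,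
      upper_triangularD, lower_triangularAlgebraMap, AlgHom.commutes, lower_triangularD,
      upper_triangularAlgebraMap, ι_mul_ι, frobΩ_two_D, ← Algebra.smul_def, ← mul_smul_comm,
      ← map_smul, add_right_comm, ← mul_add, ← map_add, dlog_mul_add_self]
  obtain ⟨F, h0, h1⟩ := exists_ringHom (triangularAlgebraMap A) triangularAlgebraMap_comm f hf
    fun a => by
      refine triangular_ext ?_ ?_
      · rw [lower_mul, lower_mul, hl, hl, hl, ι_mul_ι]
      -- The right side is zero by closedness, and the left side is twice `dlog[-1]·da·da`.
      · rw [upper_mul, upper_mul, htwo, hdlog, hD, lower_triangularD, upper_triangularD,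
          mul_zero, zero_mul, add_zero, ← mul_assoc, invol_mul_ι, mul_assoc, dlog_mul_add_self]
  exact ⟨F, h0, fun a => by rw [h1, hD]⟩

theorem exists_derivative (A : Type u) [CommRing A] :
    ∃ d : OmegaHat A →+ OmegaHat A,
      (∀ x y, d (x * y) = d x * y + invol A x * d y) ∧
      (∀ a, d (algebraMap _ _ a) = ι A (D ℤ (BigWitt A) a)) ∧
      ∀ a, d (ι A (D ℤ (BigWitt A) a)) = ι A (dlogNegOne A) * ι A (D ℤ (BigWitt A) a) := by
  obtain ⟨F, h0, h1⟩ := exists_triangularHom A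
  -- `F` is a section of the projection to the lower entry, so its upper entry satisfies the Leibniz
  -- rule over the identity.
  have hl : ∀ x, lower (F x) = x := by
    intro x
    induction x using induction with
    | algebraMap a => rw [h0, lower_triangularAlgebraMap]
    | add x y hx hy => rw [map_add, lower_add, hx, hy]
    | smul a x hx =>
      rw [Algebra.smul_def, map_mul, lower_mul, hx, h0, lower_triangularAlgebraMap]
    | D_mul a x hx => rw [map_mul, lower_mul, hx, h1, lower_triangularD]
  refine ⟨⟨⟨fun x => upper (F x), ?_⟩, fun x y => ?_⟩, fun x y => ?_, fun a => ?_, fun a => ?_⟩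
  · exact congrArg upper (map_zero F)
  · exact (congrArg upper (map_add F x y)).trans (upper_add _ _)
  · change upper (F (x * y)) = upper (F x) * y + invol A x * upper (F y)
    rw [map_mul, upper_mul, hl, hl, add_comm]
  · exact (congrArg upper (h0 a)).trans (upper_triangularAlgebraMap a)
  · exact (congrArg upper (h1 a)).trans (upper_triangularD a)

/-- The derivation of `Ω̂`. -/
def derivative (A : Type u) [CommRing A] : OmegaHat A →+ OmegaHat A := (exists_derivative A).choose

theorem derivative_mul (x y : OmegaHat A) :
    derivative A (x * y) = derivative A x * y + invol A x * derivative A y :=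
  (exists_derivative A).choose_spec.1 x y

theorem derivative_algebraMap (a : BigWitt A) :
    derivative A (algebraMap _ _ a) = ι A (D ℤ (BigWitt A) a) :=
  (exists_derivative A).choose_spec.2.1 a

theorem derivative_ι_D (a : BigWitt A) : derivative A (ι A (D ℤ (BigWitt A) a)) =
    ι A (dlogNegOne A) * ι A (D ℤ (BigWitt A) a) :=
  (exists_derivative A).choose_spec.2.2 a

theorem derivative_smul (a : BigWitt A) (x : OmegaHat A) :
    derivative A (a • x) = ι A (D ℤ (BigWitt A) a) * x + a • derivative A x := by
  rw [Algebra.smul_def, derivative_mul, derivative_algebraMap, AlgHom.commutes, Algebra.smul_def]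

theorem derivative_D_mul (a : BigWitt A) (x : OmegaHat A) :
    derivative A (ι A (D ℤ (BigWitt A) a) * x) =
      ι A (dlogNegOne A) * (ι A (D ℤ (BigWitt A) a) * x) -
        ι A (D ℤ (BigWitt A) a) * derivative A x := by
  rw [derivative_mul, derivative_ι_D, invol_ι, mul_assoc, neg_mul, sub_eq_add_neg]

theorem derivative_dlog : derivative A (ι A (dlogNegOne A)) = 0 := by
  have h := D_teichmuller_neg_one (A := A)
  rw [dlogNegOne, map_smul, derivative_smul, derivative_ι_D, ← mul_smul_comm, ← map_smul,
    ← dlogNegOne, h, map_smul, smul_mul_smul_comm, teichmuller_neg_one_sq, one_smul,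
    dlog_mul_add_self]

theorem derivative_dlog_mul (x : OmegaHat A) :
    derivative A (ι A (dlogNegOne A) * x) = ι A (dlogNegOne A) * derivative A x := by
  rw [derivative_mul, derivative_dlog, invol_ι, neg_dlog, zero_mul, zero_add]

theorem derivative_frobΩ_two (a : BigWitt A) :
    derivative A (ι A (frobΩ 2 (D ℤ (BigWitt A) a))) = 0 := by
  have h : ι A (frobΩ 2 (D ℤ (BigWitt A) a)) =
      a • ι A (D ℤ (BigWitt A) a) + ι A (D ℤ (BigWitt A) ((delta a).coeff 2)) := by
    rw [frobΩ_two_D, map_add, map_smul]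
  rw [h, map_add, derivative_smul, derivative_ι_D, derivative_ι_D, ι_mul_ι, h, ← mul_smul_comm,
    add_assoc, ← mul_add, dlog_mul_add_self]

theorem derivative_derivative (x : OmegaHat A) :
    derivative A (derivative A x) = ι A (dlogNegOne A) * derivative A x := by
  induction x using induction with
  | algebraMap a => rw [derivative_algebraMap, derivative_ι_D]
  | add x y hx hy => rw [map_add, map_add, mul_add, hx, hy]
  | smul a x hx =>
    rw [derivative_smul, map_add, derivative_D_mul, derivative_smul, hx, mul_add, mul_smul_comm]
    abel
  | D_mul a x hx =>
    -- The terms `dlog[-1]·da·dx` and `da·dlog[-1]·dx` cancel, since `dlog[-1]` commutes with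
    -- one-forms.
    rw [derivative_D_mul, map_sub, derivative_dlog_mul, derivative_D_mul, derivative_D_mul, hx,
      mul_sub, ← mul_assoc (ι A (D ℤ (BigWitt A) a)), ι_mul_dlog, mul_assoc]
    abel

theorem derivative_mem {q : ℕ} {x : OmegaHat A} (hx : x ∈ gr A q) :
    derivative A x ∈ gr A (q + 1) := by
  refine gr_induction (P := fun q x => x ∈ gr A q ∧ derivative A x ∈ gr A (q + 1)) (fun a => ?_)
    (fun q x y hx hy => ?_) (fun q w x hx ih => ⟨ι_mul_mem w hx, ?_⟩) hx |>.2
  · rw [derivative_algebraMap]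
    exact ⟨algebraMap_mem a, ι_mem _⟩
  · rw [map_add]
    exact ⟨add_mem hx.1 hy.1, add_mem hx.2 hy.2⟩
  · induction (span_range_derivation ℤ (BigWitt A)).ge
      (Submodule.mem_top (x := w)) using Submodule.span_induction with
    | zero => rw [map_zero, zero_mul, map_zero]; exact zero_mem _
    | add _ _ _ _ h1 h2 => rw [map_add, add_mul, map_add]; exact add_mem h1 h2
    | smul a _ _ h =>
      rw [map_smul, smul_mul_assoc, derivative_smul]
      exact add_mem (ι_mul_mem _ (ι_mul_mem _ hx)) (Submodule.smul_mem _ _ h)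
    | mem _ h =>
      obtain ⟨a, rfl⟩ := h
      rw [derivative_D_mul]
      exact sub_mem (ι_mul_mem _ (ι_mul_mem _ hx)) (ι_mul_mem _ ih.2)

theorem isExteriorDerivative_derivative : IsExteriorDerivative (derivative A) where
  map_mem _ _ hx := derivative_mem hx
  leibniz q x hx y := by rw [derivative_mul, invol_homogeneous hx, mul_assoc]
  map_algebraMap := derivative_algebraMap
  map_map := derivative_derivative

/-- The condition on `dd`, applied in degree zero, fixes the value on `da`; the Leibniz rule then
determines everything from generators. -/
theorem IsExteriorDerivative.eq_derivative {d : OmegaHat A →+ OmegaHat A}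
    (hd : IsExteriorDerivative d) : d = derivative A := by
  have hD : ∀ a, d (ι A (D ℤ (BigWitt A) a)) =
      ι A (dlogNegOne A) * ι A (D ℤ (BigWitt A) a) := by
    intro a
    rw [← hd.map_algebraMap, hd.map_map]
  refine AddMonoidHom.ext fun x => ?_
  induction x using induction with
  | algebraMap a => rw [hd.map_algebraMap, derivative_algebraMap]
  | add x y hx hy => rw [map_add, map_add, hx, hy]
  | smul a x hx =>
    rw [derivative_smul, Algebra.smul_def, hd.leibniz 0 _ (algebraMap_mem a), hd.map_algebraMap,
      pow_zero, one_mul, hx, ← Algebra.smul_def]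
  | D_mul a x hx =>
    rw [derivative_D_mul, hd.leibniz 1 _ (ι_mem _), hD, hx, pow_one, neg_one_mul, sub_eq_add_neg,
      mul_assoc]

end Derivative

/-! ### The Frobenius on `Ω̂` and its commutation with the derivation. -/

section Frobenius

theorem exists_isFrobenius (A : Type u) [CommRing A] (n : ℕ+) :
    ∃ F : OmegaHat A →+* OmegaHat A, IsFrobenius n F := by
  obtain ⟨F, h0, h1⟩ := exists_ringHom
    ((algebraMap (BigWitt A) (OmegaHat A)).comp (frobenius n))
    (fun a b => Algebra.commutes (frobenius n a) b)
    ((ι A).toAddMonoidHom.comp (frobΩ n).toAddMonoidHom)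
    (fun a w => by
      change ι A (frobΩ n (a • w)) = algebraMap _ _ (frobenius n a) * ι A (frobΩ n w)
      rw [map_smulₛₗ, map_smul, Algebra.smul_def])
    fun a => by
      change ι A (frobΩ n _) * ι A (frobΩ n _) = ι A (frobΩ n _) * ι A (frobΩ n _)
      -- The square of `F_n(da)` is `dlog[-1]·F_2F_n(da)`, and `F_2F_n = F_{2n} = F_nF_2`.
      rw [frobΩ_dlogNegOne, ι_mul_self, frobΩ_frobΩ, frobΩ_frobΩ, mul_comm]
  refine ⟨F, fun q x hx => ?_, h0, h1⟩
  refine gr_induction (P := fun q x => F x ∈ gr A q) (fun a => ?_)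
    (fun q x y hx hy => ?_) (fun q w x _ hx => ?_) hx
  · rw [h0]
    exact algebraMap_mem _
  · rw [map_add]
    exact add_mem hx hy
  · rw [map_mul, h1]
    exact ι_mul_mem _ hx

theorem IsFrobenius.unique {n : ℕ+} {F G : OmegaHat A →+* OmegaHat A} (hF : IsFrobenius n F)
    (hG : IsFrobenius n G) : F = G :=
  ringHom_ext (fun a => by rw [hF.map_algebraMap, hG.map_algebraMap])
    fun w => by rw [hF.map_ι, hG.map_ι]

theorem IsFrobenius.comp {m n : ℕ+} {F G : OmegaHat A →+* OmegaHat A} (hF : IsFrobenius m F)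
    (hG : IsFrobenius n G) : IsFrobenius (m * n) (F.comp G) where
  map_mem q x hx := hF.map_mem q _ (hG.map_mem q x hx)
  map_algebraMap a := by
    rw [RingHom.comp_apply, hG.map_algebraMap, hF.map_algebraMap, frobenius_frobenius]
  map_ι w := by rw [RingHom.comp_apply, hG.map_ι, hF.map_ι, frobΩ_frobΩ]

theorem derivative_frobenius_algebraMap (n : ℕ+) (a : BigWitt A) :
    derivative A (algebraMap _ _ (frobenius n a)) =
      (n : ℕ) • ι A (frobΩ n (D ℤ (BigWitt A) a)) := by
  rw [derivative_algebraMap, ← ghost_delta, ← smul_dghost, frobΩ_D_eq, map_smul,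
    Nat.cast_smul_eq_nsmul]

/-- It suffices to check `dF = nFd` on exact one-forms. -/
theorem IsFrobenius.derivative_apply_of_D {n : ℕ+} {F : OmegaHat A →+* OmegaHat A}
    (hF : IsFrobenius n F) (h : ∀ a, derivative A (ι A (frobΩ n (D ℤ (BigWitt A) a))) =
      (n : ℕ) • (ι A (dlogNegOne A) * ι A (frobΩ n (D ℤ (BigWitt A) a))))
    (x : OmegaHat A) : derivative A (F x) = (n : ℕ) • F (derivative A x) := by
  induction x using induction with
  | algebraMap a =>
    rw [hF.map_algebraMap, derivative_frobenius_algebraMap, derivative_algebraMap, hF.map_ι]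
  | add x y hx hy => rw [map_add, map_add, hx, hy, map_add, map_add, smul_add]
  | smul a x hx =>
    have h2 : ∀ y, F (a • y) = algebraMap _ _ (frobenius n a) * F y := fun y => by
      rw [Algebra.smul_def, map_mul, hF.map_algebraMap]
    rw [derivative_smul, map_add, h2, h2, derivative_mul, hx, derivative_frobenius_algebraMap,
      AlgHom.commutes, map_mul, hF.map_ι, smul_add, smul_mul_assoc, mul_smul_comm]
  | D_mul a x hx =>
    rw [derivative_D_mul, map_mul, derivative_mul, hx, hF.map_ι, h, invol_ι, map_sub, map_mul,
      map_mul, map_mul, hF.map_ι, hF.map_ι, frobΩ_dlogNegOne, smul_sub, smul_mul_assoc,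
      mul_smul_comm, neg_mul, smul_neg, mul_assoc, sub_eq_add_neg]

theorem two_mul_nsmul_dlog_mul (k : ℕ) (x : OmegaHat A) :
    (2 * k) • (ι A (dlogNegOne A) * x) = 0 := by
  rw [mul_comm, mul_smul, two_nsmul, dlog_mul_add_self, smul_zero]

/-- The extra Leibniz term `k a^{k-1} da·da` is an even multiple of a product with `dlog[-1]`, hence
zero. -/
theorem derivative_pow_smul_D {k : ℕ} (hk : Even k) (a : BigWitt A) :
    derivative A (a ^ k • ι A (D ℤ (BigWitt A) a)) =
      ι A (dlogNegOne A) * (a ^ k • ι A (D ℤ (BigWitt A) a)) := by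
  obtain ⟨j, rfl⟩ := hk.two_dvd
  rw [derivative_smul, Derivation.leibniz_pow, map_nsmul, smul_mul_assoc, map_smul,
    smul_mul_assoc, ι_mul_ι, ← mul_smul_comm, two_mul_nsmul_dlog_mul, zero_add, derivative_ι_D,
    mul_smul_comm]

/-- Every quotient `n / e` is odd, so all exponents `n / e - 1` are even and the formula holds
summand by summand. -/
theorem derivative_frobΩ_D_of_odd {n : ℕ+} (hn : Odd (n : ℕ)) (a : BigWitt A) :
    derivative A (ι A (frobΩ n (D ℤ (BigWitt A) a))) =
      ι A (dlogNegOne A) * ι A (frobΩ n (D ℤ (BigWitt A) a)) := by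
  rw [frobΩ_D, map_sum, map_sum, Finset.mul_sum]
  refine Finset.sum_congr rfl fun e he => ?_
  rw [map_smul]
  have h : Odd ((n : ℕ) / e) :=
    hn.of_dvd_nat (Nat.div_dvd_of_dvd (Nat.dvd_of_mem_divisors he))
  exact derivative_pow_smul_D (Nat.Odd.sub_odd h odd_one) _

theorem IsFrobenius.derivative_apply_of_odd {n : ℕ+} {F : OmegaHat A →+* OmegaHat A}
    (hF : IsFrobenius n F) (hn : Odd (n : ℕ)) (x : OmegaHat A) :
    derivative A (F x) = (n : ℕ) • F (derivative A x) := by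
  refine hF.derivative_apply_of_D (fun a => ?_) x
  obtain ⟨k, hk⟩ := hn
  rw [derivative_frobΩ_D_of_odd ⟨k, hk⟩, hk, add_smul, one_smul, two_mul_nsmul_dlog_mul, zero_add]

theorem IsFrobenius.derivative_apply_two {F : OmegaHat A →+* OmegaHat A}
    (hF : IsFrobenius 2 F) (x : OmegaHat A) :
    derivative A (F x) = 2 • F (derivative A x) := by
  refine hF.derivative_apply_of_D (fun a => ?_) x
  -- Both sides vanish: `F_2(da)` is closed and `2 dlog[-1] = 0`.
  rw [derivative_frobΩ_two, PNat.val_ofNat, two_nsmul, dlog_mul_add_self]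

/-- The identity `dF_n = nF_nd`. -/
theorem IsFrobenius.derivative_apply {n : ℕ+} {F : OmegaHat A →+* OmegaHat A}
    (hF : IsFrobenius n F) (x : OmegaHat A) :
    derivative A (F x) = (n : ℕ) • F (derivative A x) := by
  induction n using PNat.strongInductionOn generalizing F with
  | _ n ih =>
    rcases Nat.even_or_odd (n : ℕ) with hn | hn
    · obtain ⟨k, hk⟩ := hn.two_dvd
      have hk0 : 0 < k := by have := n.pos; omega
      obtain ⟨m, rfl⟩ : ∃ m : ℕ+, (m : ℕ) = k := ⟨⟨k, hk0⟩, rfl⟩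
      obtain rfl : n = 2 * m := PNat.eq hk
      obtain ⟨G, hG⟩ := exists_isFrobenius A 2
      obtain ⟨H, hH⟩ := exists_isFrobenius A m
      have hlt : m < 2 * m := by
        rw [← PNat.coe_lt_coe, hk]
        omega
      -- By uniqueness `F_{2m} = F_2 ∘ F_m`, and the factors `2` and `m` multiply.
      rw [hF.unique (hG.comp hH), RingHom.comp_apply, hG.derivative_apply_two, ih m hlt hH,
        map_nsmul, hk, mul_smul, RingHom.comp_apply]
    · exact hF.derivative_apply_of_odd hn x

end Frobenius

end OmegaHat

end

theorem mainTheorem7 (A : Type*) [CommRing A] :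
    (∀ (p q : ℕ), ∀ x ∈ OmegaHat.gr A p, ∀ y ∈ OmegaHat.gr A q,
      x * y = (-1) ^ (p * q) * (y * x)) ∧
    ∃ d : OmegaHat A →+ OmegaHat A,
      OmegaHat.IsExteriorDerivative d ∧
      (∀ d' : OmegaHat A →+ OmegaHat A, OmegaHat.IsExteriorDerivative d' → d' = d) ∧
      d (OmegaHat.ι A (BigWitt.dlogNegOne A)) = 0 ∧
      ∀ n : ℕ+, ∃ F : OmegaHat A →+* OmegaHat A,
        OmegaHat.IsFrobenius n F ∧
        (∀ F' : OmegaHat A →+* OmegaHat A, OmegaHat.IsFrobenius n F' → F' = F) ∧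
        ∀ w, d (F w) = (n : ℕ) • F (d w) := by
  refine ⟨fun p q x hx y hy => OmegaHat.mul_comm_homogeneous hx hy, OmegaHat.derivative A,
    OmegaHat.isExteriorDerivative_derivative, fun _ hd => hd.eq_derivative,
    OmegaHat.derivative_dlog, fun n => ?_⟩
  obtain ⟨F, hF⟩ := OmegaHat.exists_isFrobenius A n
  exact ⟨F, hF, fun _ hF' => hF'.unique hF, hF.derivative_apply⟩
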